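/- HyperCTL formulas are given by $\varphi ::= a_\pi \mid \neg\varphi \mid \varphi\vee\varphi \mid \bigcirc\varphi \mid \varphi\,\mathcal U\,\varphi \mid \exists\pi.\,\varphi$, with atomic propositions $a$ and path variables $\pi$; the dual operators are $\forall\pi.\varphi\equiv\neg\exists\pi.\neg\varphi$, $\varphi_1\wedge\varphi_2\equiv\neg(\neg\varphi_1\vee\neg\varphi_2)$ and $\varphi_1\,\mathcal R\,\varphi_2\equiv\neg(\neg\varphi_1\,\mathcal U\,\neg\varphi_2)$. Over a Kripke structure $K$ (every state of which has a successor), formulas are evaluated on tuples $\langle\pi_1,\dots,\pi_n\rangle$ of paths: $a_{\pi_k}$ holds iff $a$ belongs to the first label of $\pi_k$, the operators $\bigcirc$ and $\mathcal U$ advance all paths synchronously, and $\exists\pi.\varphi$ holds iff some path $\pi$ of $K$ that starts in the current state of $\pi_n$ (in the initial state of $K$ if $n=0$) makes $\varphi$ true on $\langle\pi_1,\dots,\pi_n,\pi\rangle$; propositions of the formula that $K$ does not have are unrestricted along quantified paths. $K\models\varphi$ means that the closed formula $\varphi$ holds on the empty tuple. A specification is a Boolean combination of closed formulas that begin with a quantifier.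 The alternation depth of a formula is $1$ plus the maximum, over the branches of the syntax tree of its negation normal form, of the number of alternations between existential and universal quantifiers on the branch, where the occurrences of $\mathcal U$ and $\mathcal R$ on a branch, if there are any, count together as one additional alternation. Theorem. HyperCTL model checking is PSPACE-hard in the size of the Kripke structure, for fixed formulas of every alternation depth at least $2$: for every $k\ge 2$ there is a HyperCTL specification $\varphi$ of alternation depth $k$ such that the problem to decide, for a given finite Kripke structure $K$ (explicitly encoded as a binary word, whose length is polynomially related to the size $|K|=|S|\cdot|\mathsf{AP}|+|\delta|$), whether $K\models\varphi$ is PSPACE-hard under polynomial-time many-one reductions. -/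

import Mathlib

/-! ### Kripke structures -/

/-- A Kripke structure `(S, s₀, δ, AP, L)`; atomic propositions are drawn from `ℕ`. -/
structure KripkeStructure where
  State : Type
  start : State
  next : State → Set State
  AP : Set ℕ
  label : State → Set ℕ
  label_subset : ∀ s, label s ⊆ AP
  next_nonempty : ∀ s, (next s).Nonempty

namespace KripkeStructure

/-- An infinite sequence of labeled states. -/
abbrev Path (K : KripkeStructure) : Type := ℕ → K.State × Set ℕ

/-- The paths of `K` from the state `s`. -/
def Paths (K : KripkeStructure) (s : K.State) : Set K.Path :=
  {π | (π 0).1 = s ∧ ∀ i, (π (i + 1)).1 ∈ K.next (π i).1 ∧ (π i).2 = K.label (π i).1}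

/-- The paths of `K` from `s`, where the propositions in `AP'` that do not belong to `K` are
unrestricted. -/
def PathsExt (K : KripkeStructure) (AP' : Set ℕ) (s : K.State) : Set K.Path :=
  {π | ∃ ρ ∈ K.Paths s, ∀ i, (π i).1 = (ρ i).1 ∧
    ∃ P' ⊆ AP' \ K.AP, (π i).2 = (ρ i).2 ∪ P'}

/-- The size `|S| * |AP| + |δ|` of a Kripke structure (meaningful for finite ones). -/
noncomputable def size (K : KripkeStructure) : ℕ :=
  Nat.card K.State * K.AP.ncard + {e : K.State × K.State | e.2 ∈ K.next e.1}.ncard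

end KripkeStructure

/-! ### HyperCTL -/

/-- HyperCTL formulas whose free path variables are `π₀, …, πₙ₋₁`. The quantifier `ex` introduces
the path variable `πₙ`, so that `HyperCTL 0` consists of the closed formulas. -/
inductive HyperCTL : ℕ → Type
  | atom {n : ℕ} (a : ℕ) (k : Fin n) : HyperCTL n
  | neg {n : ℕ} (φ : HyperCTL n) : HyperCTL n
  | or {n : ℕ} (φ ψ : HyperCTL n) : HyperCTL n
  | next {n : ℕ} (φ : HyperCTL n) : HyperCTL n
  | untl {n : ℕ} (φ ψ : HyperCTL n) : HyperCTL n
  | ex {n : ℕ} (φ : HyperCTL (n + 1)) : HyperCTL n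

namespace HyperCTL

/-- The atomic propositions that occur in a formula. -/
def atoms : {n : ℕ} → HyperCTL n → Set ℕ
  | _, atom a _ => {a}
  | _, neg φ => φ.atoms
  | _, or φ ψ => φ.atoms ∪ ψ.atoms
  | _, next φ => φ.atoms
  | _, untl φ ψ => φ.atoms ∪ ψ.atoms
  | _, ex φ => φ.atoms

/-- The state in which a newly quantified path starts: the current state of the path that was
quantified last, or the initial state if there is none. -/
def branchState (K : KripkeStructure) : {n : ℕ} → (Fin n → K.Path) → K.State
  | 0, _ => K.start
  | n + 1, Ps => (Ps (Fin.last n) 0).1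

/-- The satisfaction relation `Ps ⊨ φ` for formulas over the atomic propositions `AP'`. -/
def Sat (K : KripkeStructure) (AP' : Set ℕ) : {n : ℕ} → (Fin n → K.Path) → HyperCTL n → Prop
  | _, Ps, atom a k => a ∈ (Ps k 0).2
  | _, Ps, neg φ => ¬ Sat K AP' Ps φ
  | _, Ps, or φ ψ => Sat K AP' Ps φ ∨ Sat K AP' Ps ψ
  | _, Ps, next φ => Sat K AP' (fun k t => Ps k (1 + t)) φ
  | _, Ps, untl φ ψ => ∃ i : ℕ, Sat K AP' (fun k t => Ps k (i + t)) ψ ∧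
      ∀ j < i, Sat K AP' (fun k t => Ps k (j + t)) φ
  | n, Ps, ex φ => ∃ π ∈ K.PathsExt AP' (branchState K Ps),
      Sat K AP' (Fin.snoc (α := fun _ : Fin (n + 1) => K.Path) Ps π) φ

/-- `K ⊨ φ` for a closed formula `φ`. -/
def Satisfies (K : KripkeStructure) (φ : HyperCTL 0) : Prop :=
  Sat K φ.atoms Fin.elim0 φ

/-- A specification is a Boolean combination of closed formulas that begin with a quantifier. -/
def IsSpecification : {n : ℕ} → HyperCTL n → Prop
  | _, ex _ => True
  | _, neg φ => φ.IsSpecification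
  | _, or φ ψ => φ.IsSpecification ∧ ψ.IsSpecification
  | _, _ => False

/-- The largest number of alternations on a branch of the syntax tree of the negation normal form.
The negation normal form is not built explicitly: `pol` says whether the current subformula occurs
below an even number of negations, so that `ex` stands for `∃` if `pol = true` and for `∀` if
`pol = false`, and `untl` stands for `U` or for its dual `R`. The argument `last` is the kind of
the innermost enclosing quantifier, and `seen` tells whether some `U` or `R` was met on the branch
already: the occurrences of `U` and `R` on a branch count together as one additional
alternation. -/
def alternations : {n : ℕ} → HyperCTL n → (pol : Bool) → (last : Option Bool) → (seen : Bool) → ℕ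
  | _, atom _ _, _, _, _ => 0
  | _, neg φ, pol, last, seen => φ.alternations (!pol) last seen
  | _, or φ ψ, pol, last, seen =>
      max (φ.alternations pol last seen) (ψ.alternations pol last seen)
  | _, next φ, pol, last, seen => φ.alternations pol last seen
  | _, untl φ ψ, pol, last, seen => (if seen then 0 else 1) +
      max (φ.alternations pol last true) (ψ.alternations pol last true)
  | _, ex φ, pol, last, seen => (if last = some (!pol) then 1 else 0) +
      φ.alternations pol (some pol) seen

/-- The alternation depth of a formula. -/
def alternationDepth {n : ℕ} (φ : HyperCTL n) : ℕ :=
  1 + φ.alternations true none false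

end HyperCTL

/-! ### Finite Kripke structures as inputs of machines -/

/-- A finite Kripke structure with states `0, …, numStates - 1` and atomic propositions
`0, …, numProps - 1`. -/
structure FinKripke where
  numStates : ℕ
  numProps : ℕ
  start : Fin numStates
  edge : Fin numStates → Fin numStates → Bool
  label : Fin numStates → Fin numProps → Bool
  edge_total : ∀ s, ∃ t, edge s t = true

namespace FinKripke

/-- The Kripke structure that is described by a finite presentation. -/
def toKripke (K : FinKripke) : KripkeStructure where
  State := Fin K.numStates
  start := K.start
  next s := {t | K.edge s t = true}
  AP := {a | a < K.numProps}
  label s := {a | ∃ h : a < K.numProps, K.label s ⟨a, h⟩ = true}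
  label_subset _ _ h := h.1
  next_nonempty s := K.edge_total s

/-- The binary encoding: the number of states, the number of propositions and the initial state
in unary, followed by a row for each state, which holds its labels and its row of the adjacency
matrix. -/
def encode (K : FinKripke) : List Bool :=
  List.replicate K.numStates true ++ false :: (List.replicate K.numProps true ++ false ::
    (List.replicate K.start.val true ++ false ::
      (List.ofFn fun s => List.ofFn (K.label s) ++ List.ofFn (K.edge s)).flatten))

private theorem unary_inj {a b : ℕ} {l l' : List Bool}
    (h : List.replicate a true ++ false :: l = List.replicate b true ++ false :: l') :
    a = b ∧ l = l' := by
  induction a generalizing b with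
  | zero => cases b <;> simp_all [List.replicate_succ]
  | succ a ih =>
    cases b with
    | zero => simp [List.replicate_succ] at h
    | succ b =>
      simp only [List.replicate_succ, List.cons_append, List.cons.injEq, true_and] at h
      obtain ⟨h1, h2⟩ := ih h
      exact ⟨by rw [h1], h2⟩

private theorem flatten_ofFn_inj {α : Type} {m n : ℕ} {f g : Fin n → List α}
    (hf : ∀ i, (f i).length = m) (hg : ∀ i, (g i).length = m)
    (h : (List.ofFn f).flatten = (List.ofFn g).flatten) : f = g := by
  induction n with
  | zero => exact funext fun i => i.elim0
  | succ n ih =>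
    simp only [List.ofFn_succ, List.flatten_cons] at h
    obtain ⟨h1, h2⟩ := List.append_inj h (by rw [hf, hg])
    have h3 := ih (fun i => hf i.succ) (fun i => hg i.succ) h2
    funext i
    refine Fin.cases h1 (fun j => congrFun h3 j) i

/-- Different finite Kripke structures have different encodings. -/
theorem encode_injective : Function.Injective encode := by
  rintro ⟨n, m, s, e, l, ht⟩ ⟨n', m', s', e', l', ht'⟩ h
  simp only [encode] at h
  obtain ⟨rfl, h⟩ := unary_inj h
  obtain ⟨rfl, h⟩ := unary_inj h
  obtain ⟨h1, h⟩ := unary_inj h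
  have h2 := flatten_ofFn_inj (m := m + n) (by simp) (by simp) h
  have h3 : ∀ i, l i = l' i ∧ e i = e' i := fun i => by
    obtain ⟨h4, h5⟩ := List.append_inj (congrFun h2 i) (by simp)
    exact ⟨List.ofFn_injective h4, List.ofFn_injective h5⟩
  obtain rfl : l = l' := funext fun i => (h3 i).1
  obtain rfl : e = e' := funext fun i => (h3 i).2
  obtain rfl := Fin.ext h1
  rfl

/-- The size of a Kripke structure is at most the length of its encoding. -/
theorem size_le_length_encode (K : FinKripke) : K.toKripke.size ≤ K.encode.length := by
  have h1 : {e : Fin K.numStates × Fin K.numStates | K.edge e.1 e.2 = true}.ncard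
      ≤ K.numStates * K.numStates := by
    have := Set.ncard_le_card {e : Fin K.numStates × Fin K.numStates | K.edge e.1 e.2 = true}
    simpa using this
  have h2 : {a : ℕ | a < K.numProps}.ncard = K.numProps := by
    have : {a : ℕ | a < K.numProps} = (Finset.range K.numProps : Set ℕ) := by ext; simp
    rw [this, Set.ncard_coe_finset, Finset.card_range]
  have h3 : K.encode.length = K.numStates + (K.numProps + (K.start.val +
      (K.numStates * K.numProps + K.numStates * K.numStates) + 1) + 1) + 1 := by
    simp [encode, List.length_flatten, List.map_ofFn, Function.comp_def]
    ring
  have h4 : K.toKripke.size = K.numStates * K.numProps +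
      {e : Fin K.numStates × Fin K.numStates | K.edge e.1 e.2 = true}.ncard := by
    simp only [KripkeStructure.size, toKripke, h2, Nat.card_eq_fintype_card, Fintype.card_fin]
    rfl
  omega

/-- The length of the encoding is polynomially bounded in the size of the Kripke structure. -/
theorem length_encode_le (K : FinKripke) :
    K.encode.length ≤ 8 * (K.toKripke.size + 1) ^ 2 := by
  have h1 : K.numStates ≤
      {e : Fin K.numStates × Fin K.numStates | K.edge e.1 e.2 = true}.ncard := by
    choose f hf using K.edge_total
    have := Set.ncard_le_ncard (s := Set.range fun s => (s, f s))
      (t := {e : Fin K.numStates × Fin K.numStates | K.edge e.1 e.2 = true})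
      (by rintro _ ⟨s, rfl⟩; exact hf s) (Set.toFinite _)
    rwa [← Set.image_univ, Set.ncard_image_of_injective _ (fun a b h => (Prod.ext_iff.1 h).1),
      Set.ncard_univ, Nat.card_eq_fintype_card, Fintype.card_fin] at this
  have h2 : {a : ℕ | a < K.numProps}.ncard = K.numProps := by
    have : {a : ℕ | a < K.numProps} = (Finset.range K.numProps : Set ℕ) := by ext; simp
    rw [this, Set.ncard_coe_finset, Finset.card_range]
  have h3 : K.encode.length = K.numStates + (K.numProps + (K.start.val +
      (K.numStates * K.numProps + K.numStates * K.numStates) + 1) + 1) + 1 := by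
    simp [encode, List.length_flatten, List.map_ofFn, Function.comp_def]
    ring
  have h4 : K.toKripke.size = K.numStates * K.numProps +
      {e : Fin K.numStates × Fin K.numStates | K.edge e.1 e.2 = true}.ncard := by
    simp only [KripkeStructure.size, toKripke, h2, Nat.card_eq_fintype_card, Fintype.card_fin]
    rfl
  have h5 := K.start.isLt
  have h6 : K.numProps ≤ K.numStates * K.numProps := Nat.le_mul_of_pos_left _ (by omega)
  have h7 : K.numStates ≤ K.toKripke.size := by omega
  have h8 := Nat.mul_le_mul h7 h7
  rw [h3]
  nlinarith

end FinKripke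

/-- The model checking problem for the fixed formula `φ`. -/
def modelChecking (φ : HyperCTL 0) : Set FinKripke :=
  {K | HyperCTL.Satisfies K.toKripke φ}

/-! ### Polynomial space -/

/-- A deterministic Turing machine with one tape, whose cells are numbered by `ℕ`. A machine that
moves left on cell `0` stays there. -/
structure SpaceTM where
  State : Type
  Sym : Type
  [stateFin : Fintype State]
  [symFin : Fintype Sym]
  start : State
  accept : State
  reject : State
  accept_ne_reject : accept ≠ reject
  blank : Sym
  input : Bool → Sym
  input_injective : Function.Injective input
  input_ne_blank : ∀ b, input b ≠ blank
  trans : State → Sym → State × Sym × Turing.Dir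

namespace SpaceTM

/-- A configuration: the state, the position of the head, and the contents of the tape. -/
structure Cfg (M : SpaceTM) where
  state : M.State
  head : ℕ
  tape : ℕ → M.Sym

open Classical in
/-- One step of the machine; configurations in the accepting or rejecting state are final. -/
noncomputable def step (M : SpaceTM) (c : M.Cfg) : M.Cfg :=
  if c.state = M.accept ∨ c.state = M.reject then c
  else
    let r := M.trans c.state (c.tape c.head)
    { state := r.1
      head := match r.2.2 with
        | Turing.Dir.left => c.head - 1
        | Turing.Dir.right => c.head + 1
      tape := Function.update c.tape c.head r.2.1 }

/-- The initial configuration on the input `x`. -/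
def initial (M : SpaceTM) (x : List Bool) : M.Cfg where
  state := M.start
  head := 0
  tape i := (x[i]?).elim M.blank M.input

/-- The configuration after `t` steps on the input `x`. -/
noncomputable def run (M : SpaceTM) (x : List Bool) (t : ℕ) : M.Cfg :=
  M.step^[t] (M.initial x)

/-- `M` halts on every input, accepts exactly the words of `L`, and scans at most `s n` cells on
inputs of length `n`. -/
def DecidesInSpace (M : SpaceTM) (L : Language Bool) (s : ℕ → ℕ) : Prop :=
  ∀ x : List Bool,
    (x ∈ L → ∃ t, (M.run x t).state = M.accept) ∧
    (x ∉ L → ∃ t, (M.run x t).state = M.reject) ∧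
    ∀ t, (M.run x t).head < s x.length

end SpaceTM

/-- The complexity class PSPACE. -/
def InPSPACE (L : Language Bool) : Prop :=
  ∃ (M : SpaceTM) (p : Polynomial ℕ), M.DecidesInSpace L fun n => p.eval n

/-- A decision problem `P`, whose instances are encoded by `enc`, is PSPACE-hard under
polynomial-time many-one reductions. -/
def PSPACEHard {α Γ : Type} (enc : α → List Γ) (P : Set α) : Prop :=
  ∀ L : Language Bool, InPSPACE L →
    ∃ f : List Bool → α,
      Nonempty (Turing.TM2ComputableInPolyTime (fun x : List Bool => x) enc f) ∧
      ∀ x, x ∈ L ↔ f x ∈ P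

/-! Fix a machine `M` that decides a language in polynomial space. Write its run on `x` as one
infinite word of cells: the configurations follow each other in rows of equal length, separated by
walls. Every cell beyond the first row is a fixed function of three consecutive cells about one row
earlier. A correct run is therefore a word with a prescribed beginning that obeys a local rule at
one fixed delay. The rule depends on `M` only; the delay and the beginning depend on `x`.

The Kripke structure keeps these two kinds of data apart. Its core depends on `M` only: it guesses
the word bit by bit, remembers a window of three cells, and announces through the propositions `2`
and `3` the bit that is due after the delay. Attached to it is a line of states as long as the
delay. Every core state can branch onto the line, and from there the path is forced. The line is a
ruler: while a branching path walks along it, the main path advances by exactly the delay, and its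
bit is inspected at the end of the walk. The line also carries the bits of the first row, so one
walk from the initial state checks the beginning.

A single formula, independent of `M` and `x`, expresses this. Since the walk along the line is
deterministic, existential quantifiers suffice, and the only alternation comes from `U` and `R`;
this gives depth 2. A disjunction with an unsatisfiable formula yields every larger depth.

Correctness is the chain `Core.attach_satisfies_iff` (formula and bits),
`DelaySystem.exists_delayRun_iff` (bits and cells), `SpaceTM.exists_accepting_run_iff` (cells and
machine). Efficiency is `SpaceTM.polyTime_reduction`: the encoding is written by a program in a
small loop language over stacks, whose compilation into a stack machine is justified by
`Cmd.Run.reaches`. -/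

/-! ### Derived operators of HyperCTL -/

namespace HyperCTL

/-- Conjunction. -/
def conj {n : ℕ} (φ ψ : HyperCTL n) : HyperCTL n := neg (or (neg φ) (neg ψ))

/-- Implication. -/
def imp {n : ℕ} (φ ψ : HyperCTL n) : HyperCTL n := or (neg φ) ψ

/-- A tautology without quantifiers. -/
def verum {n : ℕ} : HyperCTL (n + 1) := or (atom 0 0) (neg (atom 0 0))

/-- The operator `eventually`. -/
def ev {n : ℕ} (φ : HyperCTL (n + 1)) : HyperCTL (n + 1) := untl verum φ

/-- The operator `globally`. -/
def glob {n : ℕ} (φ : HyperCTL (n + 1)) : HyperCTL (n + 1) := neg (ev (neg φ))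

section Sat

variable {K : KripkeStructure} {AP' : Set ℕ} {n : ℕ}

theorem sat_conj {Ps : Fin n → K.Path} {φ ψ : HyperCTL n} :
    Sat K AP' Ps (conj φ ψ) ↔ Sat K AP' Ps φ ∧ Sat K AP' Ps ψ := by
  simp [conj, Sat]

theorem sat_imp {Ps : Fin n → K.Path} {φ ψ : HyperCTL n} :
    Sat K AP' Ps (imp φ ψ) ↔ (Sat K AP' Ps φ → Sat K AP' Ps ψ) := by
  simp [imp, Sat, imp_iff_not_or]

theorem sat_verum {Ps : Fin (n + 1) → K.Path} : Sat K AP' Ps verum := by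
  simp [verum, Sat, em]

theorem sat_ev {Ps : Fin (n + 1) → K.Path} {φ : HyperCTL (n + 1)} :
    Sat K AP' Ps (ev φ) ↔ ∃ i, Sat K AP' (fun k t => Ps k (i + t)) φ := by
  simp [ev, Sat, sat_verum]

theorem sat_glob {Ps : Fin (n + 1) → K.Path} {φ : HyperCTL (n + 1)} :
    Sat K AP' Ps (glob φ) ↔ ∀ i, Sat K AP' (fun k t => Ps k (i + t)) φ := by
  simp [glob, Sat, sat_ev]

end Sat

/-- On the path that follows a line, `ψ` holds in the last state of the line and `χ` holds in the
states of the line before. -/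
def alongLine (χ ψ : HyperCTL 2) : HyperCTL 1 :=
  ex (next (untl (conj (atom 1 1) χ) (conj (atom 1 1) (conj ψ (next (neg (atom 1 1)))))))

/-- The bits of the two paths agree. -/
def sameBit : HyperCTL 2 :=
  conj (imp (atom 0 0) (atom 0 1)) (imp (atom 0 1) (atom 0 0))

/-- Some path encodes an accepting run of the delay system that is described by the structure. The
propositions are: `0`, the bit of a state; `1`, the state belongs to the line; `2` and `3`, the bit
after a delay that is the length of the line is required to be false or true; `4`, accepting. -/
def delayFormula : HyperCTL 0 :=
  ex (conj (alongLine sameBit sameBit)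
    (conj
      (glob (conj (neg (atom 1 0))
        (conj (imp (atom 2 0) (alongLine verum (neg (atom 0 0))))
          (imp (atom 3 0) (alongLine verum (atom 0 0))))))
      (ev (atom 4 0))))

/-- Formulas with alternating quantifiers. -/
def altChain : ℕ → {n : ℕ} → HyperCTL (n + 1)
  | 0, _ => atom 0 0
  | j + 1, _ => ex (neg (altChain j))

/-- An unsatisfiable formula that begins with a quantifier and has `j` alternations. -/
def altFalse (j : ℕ) : HyperCTL 0 := ex (neg (or (altChain j) (neg (altChain j))))

/-- The formula `delayFormula` padded to a prescribed alternation depth. -/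
def paddedFormula (k : ℕ) : HyperCTL 0 := or delayFormula (altFalse (k - 1))

/-- A negation follows each `ex` of the chain, so successive quantifiers have opposite kinds. The
enclosing quantifier is also opposite to the first one, hence each of the `j` quantifiers
contributes exactly one alternation. -/
theorem alternations_altChain (j : ℕ) {n : ℕ} (pol : Bool) (seen : Bool) :
    (altChain j (n := n)).alternations (!pol) (some pol) seen = j := by
  induction j generalizing n pol with
  | zero => simp [altChain, alternations]
  | succ j ih =>
    have := ih (n := n + 1) (!pol)
    simp only [Bool.not_not] at this
    simp [altChain, alternations, this, add_comm]

/-- This serves the second, negated copy of the chain in `altFalse`: there the first quantifier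
agrees with the enclosing one, and one alternation is lost. -/
theorem alternations_altChain_le (j : ℕ) {n : ℕ} (pol : Bool) (seen : Bool) :
    (altChain j (n := n)).alternations pol (some pol) seen ≤ j := by
  cases j with
  | zero => simp [altChain, alternations]
  | succ j =>
    have := alternations_altChain j (n := n + 1) pol seen
    simp [altChain, alternations, this]

theorem alternationDepth_paddedFormula {k : ℕ} (hk : 2 ≤ k) :
    (paddedFormula k).alternationDepth = k := by
  -- Every quantifier of `delayFormula` occurs positively, so only `U` and `R` count.
  have h1 : delayFormula.alternations true none false = 1 := by
    simp [delayFormula, alongLine, sameBit, conj, imp, glob, ev, verum, alternations]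
  have h2 := alternations_altChain (k - 1) (n := 0) true false
  have h3 := alternations_altChain_le (k - 1) (n := 0) true false
  simp only [Bool.not_true] at h2
  simp only [paddedFormula, alternationDepth, alternations, h1, altFalse, Bool.not_true, h2,
    Bool.not_false]
  simp
  omega

theorem isSpecification_paddedFormula (k : ℕ) : (paddedFormula k).IsSpecification := by
  simp [paddedFormula, delayFormula, altFalse, IsSpecification]

theorem atoms_altChain (j : ℕ) {n : ℕ} : (altChain j (n := n)).atoms = {0} := by
  induction j generalizing n with
  | zero => rfl
  | succ j ih => simp [altChain, atoms, ih]

/-- The structures of the reduction have the propositions `0, …, 4`, so by `pathsExt_eq` no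
proposition of the formula is unrestricted on their paths. -/
theorem atoms_paddedFormula (k : ℕ) : (paddedFormula k).atoms ⊆ {a | a < 5} := by
  simp [paddedFormula, delayFormula, altFalse, alongLine, sameBit, conj, imp, glob, ev, verum,
    atoms, atoms_altChain, Set.insert_subset_iff]

theorem sat_paddedFormula {K : KripkeStructure} {AP' : Set ℕ} {Ps : Fin 0 → K.Path} (k : ℕ) :
    Sat K AP' Ps (paddedFormula k) ↔ Sat K AP' Ps delayFormula := by
  have : ¬ Sat K AP' Ps (altFalse (k - 1)) := by
    simp [altFalse, Sat, em]
  simp [paddedFormula, Sat, this]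

end HyperCTL

/-! ### Paths as sequences of states -/

namespace KripkeStructure

/-- The path along a sequence of states. -/
def pathOf (K : KripkeStructure) (ρ : ℕ → K.State) : K.Path := fun i => (ρ i, K.label (ρ i))

theorem paths_eq_image (K : KripkeStructure) (s : K.State) :
    K.Paths s = K.pathOf '' {ρ | ρ 0 = s ∧ ∀ i, ρ (i + 1) ∈ K.next (ρ i)} := by
  ext π
  constructor
  · rintro ⟨h1, h2⟩
    exact ⟨fun i => (π i).1, ⟨h1, fun i => (h2 i).1⟩,
      funext fun i => Prod.ext rfl (h2 i).2.symm⟩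
  · rintro ⟨ρ, ⟨h1, h2⟩, rfl⟩
    exact ⟨h1, fun i => ⟨h2 i, rfl⟩⟩

theorem pathsExt_eq {K : KripkeStructure} {AP' : Set ℕ} (h : AP' ⊆ K.AP) (s : K.State) :
    K.PathsExt AP' s = K.Paths s := by
  ext π
  have h0 : AP' \ K.AP = ∅ := Set.sdiff_eq_empty.2 h
  simp only [PathsExt, h0, Set.subset_empty_iff, Set.mem_ofPred_eq]
  constructor
  · rintro ⟨ρ, hρ, h⟩
    have : π = ρ := funext fun i => by
      obtain ⟨h1, P, rfl, h2⟩ := h i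
      exact Prod.ext h1 (by simpa using h2)
    exact this ▸ hρ
  · intro hπ
    exact ⟨π, hπ, fun i => ⟨rfl, ∅, rfl, by simp⟩⟩

/-- Every state is the start of a path. -/
theorem exists_path (K : KripkeStructure) (s : K.State) :
    ∃ ρ : ℕ → K.State, ρ 0 = s ∧ ∀ i, ρ (i + 1) ∈ K.next (ρ i) := by
  choose g hg using K.next_nonempty
  refine ⟨fun i => g^[i] s, rfl, fun i => ?_⟩
  simp only [Function.iterate_succ_apply']
  exact hg _

end KripkeStructure

/-- The demand for `line` at all earlier positions confines the witness to the first stretch of the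
line, even if the line is visited again later. Its failure at the next position makes the witness
the last position of this stretch. -/
theorem exists_until_iff {N : ℕ} (hN : 0 < N) {line A B : ℕ → Prop} (h1 : ∀ i < N, line i)
    (h2 : ¬ line N) :
    (∃ i, (line i ∧ A i ∧ ¬ line (i + 1)) ∧ ∀ j < i, line j ∧ B j) ↔
      A (N - 1) ∧ ∀ j < N - 1, B j := by
  constructor
  · rintro ⟨i, ⟨h3, h4, h5⟩, h6⟩
    have h7 : i < N := by
      rcases lt_trichotomy i N with h | rfl | h
      · exact h
      · exact absurd h3 h2
      · exact absurd (h6 N h).1 h2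
    have h8 : ¬ i + 1 < N := fun h => h5 (h1 _ h)
    obtain rfl : i = N - 1 := by omega
    exact ⟨h4, fun j hj => (h6 j hj).2⟩
  · rintro ⟨h3, h4⟩
    refine ⟨N - 1, ⟨h1 _ (by omega), h3, ?_⟩, fun j hj => ⟨h1 _ (by omega), h4 j hj⟩⟩
    rwa [Nat.sub_add_cancel hN]

/-! ### Attaching a line to a finite core -/

/-- A finite labeled graph with a start state. -/
structure Core where
  size : ℕ
  start : Fin size
  edge : Fin size → Fin size → Bool
  label : Fin size → Fin 5 → Bool

open KripkeStructure

namespace Core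

/-- The labels of a state of the line with the bit `b`. -/
def lineLabel (b : Bool) (p : Fin 5) : Bool := if p = 0 then b else decide (p = 1)

/-- The states of the core are followed by a line. Every state of the core has an edge to the last
state, every state `s` of the line has an edge to `s - 1`. Along a path the line carries the
bits `ℓ`. -/
def attach (C : Core) (ℓ : List Bool) : FinKripke where
  numStates := C.size + ℓ.length
  numProps := 5
  start := Fin.castAdd _ C.start
  edge s t :=
    if hs : s.1 < C.size then
      if ht : t.1 < C.size then C.edge ⟨s, hs⟩ ⟨t, ht⟩ || decide (t.1 + 1 = C.size + ℓ.length)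
      else decide (t.1 + 1 = C.size + ℓ.length)
    else decide (t.1 + 1 = s.1)
  label s p :=
    if hs : s.1 < C.size then C.label ⟨s, hs⟩ p
    else lineLabel (ℓ.getD (C.size + ℓ.length - 1 - s.1) false) p
  edge_total s := by
    have h := C.start.pos
    by_cases hs : s.1 < C.size
    · refine ⟨⟨C.size + ℓ.length - 1, by omega⟩, ?_⟩
      by_cases ht : C.size + ℓ.length - 1 < C.size
      · simp only [hs, ht, dite_true, Bool.or_eq_true, decide_eq_true_eq]
        right; omega
      · simp only [hs, ht, dite_true, dite_false, decide_eq_true_eq]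
        omega
    · refine ⟨⟨s.1 - 1, by omega⟩, ?_⟩
      simp only [hs, dite_false, decide_eq_true_eq]
      omega

variable {C : Core} {ℓ : List Bool}

/-- The line is entered at the state with the largest number and descends one state at a time. The
case `i = ℓ.length` is included: the path is then in the core state `C.size - 1`, which marks the
end of the line. -/
theorem attach_line {ρ : ℕ → Fin (C.size + ℓ.length)}
    (hρ : ∀ i, (C.attach ℓ).edge (ρ i) (ρ (i + 1)) = true)
    (h0 : (ρ 0).1 < C.size) (h1 : C.size ≤ (ρ 1).1) (i : ℕ) (hi : i ≤ ℓ.length) :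
    (ρ (1 + i)).1 + 1 + i = C.size + ℓ.length := by
  induction i with
  | zero =>
    have := hρ 0
    simp only [attach, h0, dite_true, zero_add, not_lt.2 h1, dite_false,
      decide_eq_true_eq] at this
    simpa using this
  | succ i ih =>
    have h2 := ih (by omega)
    have := hρ (1 + i)
    have h3 : ¬ (ρ (1 + i)).1 < C.size := by omega
    simp only [attach, h3, dite_false, decide_eq_true_eq] at this
    rw [← add_assoc 1 i 1]
    omega

theorem attach_exists_line (hℓ : ℓ ≠ []) (s : Fin (C.size + ℓ.length)) (hs : s.1 < C.size) :
    ∃ ρ : ℕ → Fin (C.size + ℓ.length), ρ 0 = s ∧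
      (∀ i, (C.attach ℓ).edge (ρ i) (ρ (i + 1)) = true) ∧ C.size ≤ (ρ 1).1 := by
  have hN := List.length_pos_iff.2 hℓ
  obtain ⟨ρ, h1, h2⟩ := (C.attach ℓ).toKripke.exists_path
    (⟨C.size + ℓ.length - 1, by omega⟩ : Fin (C.size + ℓ.length))
  refine ⟨fun i => Nat.casesOn i s ρ, rfl, fun i => ?_, ?_⟩
  · cases i with
    | zero =>
      have h3 : ¬ C.size + ℓ.length - 1 < C.size := by omega
      change (C.attach ℓ).edge s (ρ 0) = true
      rw [h1]
      simp only [attach, hs, dite_true, h3, dite_false, decide_eq_true_eq]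
      omega
    | succ i => exact h2 i
  · change C.size ≤ (ρ 0).1
    rw [h1]
    simp only
    omega

theorem mem_label_attach_iff {s : Fin (C.size + ℓ.length)} {a : ℕ} (ha : a < 5) :
    a ∈ (C.attach ℓ).toKripke.label s ↔ (C.attach ℓ).label s ⟨a, ha⟩ = true :=
  ⟨fun ⟨_, h⟩ => h, fun h => ⟨ha, h⟩⟩

/-- A sequence of states of the core satisfies the constraints on the bits. -/
structure IsDelayRun (C : Core) (ℓ : List Bool) (ρ : ℕ → Fin C.size) : Prop where
  start : ρ 0 = C.start
  edge : ∀ t, C.edge (ρ t) (ρ (t + 1)) = true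
  initial : ∀ j (hj : j < ℓ.length), C.label (ρ (1 + j)) 0 = ℓ[j]
  out_false : ∀ t, C.label (ρ t) 2 = true → C.label (ρ (t + ℓ.length)) 0 = false
  out_true : ∀ t, C.label (ρ t) 3 = true → C.label (ρ (t + ℓ.length)) 0 = true

open HyperCTL

theorem line_label_iff (hC : ∀ q, C.label q 1 = false) {s : Fin (C.size + ℓ.length)} :
    1 ∈ (C.attach ℓ).toKripke.label s ↔ C.size ≤ s.1 := by
  rw [mem_label_attach_iff (by norm_num)]
  by_cases hs : s.1 < C.size
  · simp only [attach, hs, dite_true, not_le.2 hs, iff_false, Bool.not_eq_true]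
    exact hC _
  · simp only [attach, hs, dite_false, not_lt.1 hs, iff_true]
    rfl

/-- All paths that step onto the line from the current state agree along it, so the quantifier
disappears and conditions on positions remain. The first step is spent on entering the line, hence
the shift by `1`. -/
theorem sat_alongLine_iff (hC : ∀ q, C.label q 1 = false) (hℓ : ℓ ≠ []) {AP' : Set ℕ} (hAP : AP' ⊆ (C.attach ℓ).toKripke.AP)
    {Ps : Fin 1 → (C.attach ℓ).toKripke.Path} (h0 : (Ps 0 0).1.1 < C.size)
    {χ ψ : HyperCTL 2} {A B : ℕ → Prop}
    (hψ : ∀ π' : ℕ → Fin (C.size + ℓ.length),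
      (∀ i ≤ ℓ.length, (π' (1 + i)).1 + 1 + i = C.size + ℓ.length) → ∀ i,
      i < ℓ.length → (Sat (C.attach ℓ).toKripke AP' (fun k t =>
      Fin.snoc (α := fun _ : Fin 2 => (C.attach ℓ).toKripke.Path) Ps
        ((C.attach ℓ).toKripke.pathOf π') k (1 + (i + t))) ψ ↔ A i))
    (hχ : ∀ π' : ℕ → Fin (C.size + ℓ.length),
      (∀ i ≤ ℓ.length, (π' (1 + i)).1 + 1 + i = C.size + ℓ.length) → ∀ i,
      i < ℓ.length → (Sat (C.attach ℓ).toKripke AP' (fun k t =>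
      Fin.snoc (α := fun _ : Fin 2 => (C.attach ℓ).toKripke.Path) Ps
        ((C.attach ℓ).toKripke.pathOf π') k (1 + (i + t))) χ ↔ B i)) :
    Sat (C.attach ℓ).toKripke AP' Ps (alongLine χ ψ) ↔
      A (ℓ.length - 1) ∧ ∀ j < ℓ.length - 1, B j := by
  have hN := List.length_pos_iff.2 hℓ
  have key : ∀ π' : ℕ → Fin (C.size + ℓ.length),
      (∀ i ≤ ℓ.length, (π' (1 + i)).1 + 1 + i = C.size + ℓ.length) →
      (Sat (C.attach ℓ).toKripke AP' (Fin.snoc (α := fun _ : Fin 2 => (C.attach ℓ).toKripke.Path)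
        Ps ((C.attach ℓ).toKripke.pathOf π'))
        (next (untl (conj (atom 1 1) χ) (conj (atom 1 1) (conj ψ (next (neg (atom 1 1))))))) ↔
      A (ℓ.length - 1) ∧ ∀ j < ℓ.length - 1, B j) := by
    intro π' hπ'
    simp only [Sat, sat_conj]
    rw [← hψ π' hπ' _ (by omega)]
    have hB : (∀ j < ℓ.length - 1, B j) ↔ ∀ j < ℓ.length - 1, Sat (C.attach ℓ).toKripke AP'
        (fun k t => Fin.snoc (α := fun _ : Fin 2 => (C.attach ℓ).toKripke.Path) Ps
        ((C.attach ℓ).toKripke.pathOf π') k (1 + (j + t))) χ :=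
      forall₂_congr fun j hj => (hχ π' hπ' j (by omega)).symm
    rw [hB]
    refine exists_until_iff hN (line := fun i => 1 ∈ (C.attach ℓ).toKripke.label (π' (1 + i)))
      (A := fun i => Sat (C.attach ℓ).toKripke AP' (fun k t =>
        Fin.snoc (α := fun _ : Fin 2 => (C.attach ℓ).toKripke.Path) Ps
        ((C.attach ℓ).toKripke.pathOf π') k (1 + (i + t))) ψ)
      (B := fun i => Sat (C.attach ℓ).toKripke AP' (fun k t =>
        Fin.snoc (α := fun _ : Fin 2 => (C.attach ℓ).toKripke.Path) Ps
        ((C.attach ℓ).toKripke.pathOf π') k (1 + (i + t))) χ) (fun i hi => ?_) ?_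
    · have := hπ' i hi.le
      exact (line_label_iff hC).2 (by omega)
    · have := hπ' _ le_rfl
      exact fun h => by have := (line_label_iff hC).1 h; omega
  simp only [alongLine, Sat.eq_6, pathsExt_eq hAP, paths_eq_image, Set.exists_mem_image]
  constructor
  · rintro ⟨ρ, ⟨h1, h2⟩, h3⟩
    -- Both arguments of the until formula contain proposition `1`, so a path that does not step
    -- onto the line at once fails it.
    have h4 : 1 ∈ (C.attach ℓ).toKripke.label (ρ 1) := by
      obtain ⟨i, h4, h5⟩ := h3
      rcases Nat.eq_zero_or_pos i with rfl | hi
      · exact (sat_conj.1 h4).1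
      · exact (sat_conj.1 (h5 0 hi)).1
    have h5 : (ρ 0).1 < C.size := by rw [h1]; exact h0
    exact (key ρ (attach_line h2 h5 ((line_label_iff hC).1 h4))).1 h3
  · intro h
    obtain ⟨ρ, h1, h2, h3⟩ := attach_exists_line hℓ (Ps 0 0).1 h0
    have h5 : (ρ 0).1 < C.size := by rw [h1]; exact h0
    exact ⟨ρ, ⟨h1, h2⟩, (key ρ (attach_line h2 h5 h3)).2 h⟩

theorem line_bit_iff {s : Fin (C.size + ℓ.length)} {i : ℕ} (hi : i < ℓ.length)
    (hs : s.1 + 1 + i = C.size + ℓ.length) :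
    0 ∈ (C.attach ℓ).toKripke.label s ↔ ℓ[i] = true := by
  rw [mem_label_attach_iff (by norm_num)]
  have h1 : ¬ s.1 < C.size := by omega
  have h2 : C.size + ℓ.length - 1 - s.1 = i := by omega
  simp only [attach, h1, dite_false, h2]
  simp [lineLabel, hi]

/-- Here the line is a mere clock: one step enters it and `ℓ.length - 1` further steps reach its
last state. -/
theorem sat_late_iff (hC : ∀ q, C.label q 1 = false) (hℓ : ℓ ≠ []) {AP' : Set ℕ}
    (hAP : AP' ⊆ (C.attach ℓ).toKripke.AP) {Ps : Fin 1 → (C.attach ℓ).toKripke.Path}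
    (h0 : (Ps 0 0).1.1 < C.size) {ψ : HyperCTL 2} {A : ℕ → Prop}
    (hψ : ∀ π' i, (Sat (C.attach ℓ).toKripke AP' (fun k t =>
      Fin.snoc (α := fun _ : Fin 2 => (C.attach ℓ).toKripke.Path) Ps π' k (i + t)) ψ ↔ A i)) :
    Sat (C.attach ℓ).toKripke AP' Ps (alongLine verum ψ) ↔ A ℓ.length := by
  have hN := List.length_pos_iff.2 hℓ
  rw [sat_alongLine_iff hC hℓ hAP h0 (A := fun i => A (1 + i)) (B := fun _ => True)]
  · simp only [implies_true, and_true]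
    rw [Nat.add_sub_cancel' hN]
  · intro π' _ i _
    rw [← hψ ((C.attach ℓ).toKripke.pathOf π') (1 + i)]
    simp only [add_assoc]
  · intro π' _ i _
    simp only [iff_true]
    exact sat_verum

/-- Forbidding proposition `1` globally keeps the main path in the core. At every time its state
thus has an edge to the entrance of the line, which the evaluation of the delayed conditions needs.
-/
theorem sat_delayFormula_body (hC : ∀ q, C.label q 1 = false) (hℓ : ℓ ≠ []) {AP' : Set ℕ}
    (hAP : AP' ⊆ (C.attach ℓ).toKripke.AP) {ρ : ℕ → Fin (C.size + ℓ.length)}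
    (h0 : ρ 0 = Fin.castAdd _ C.start) {Ps : Fin 1 → (C.attach ℓ).toKripke.Path}
    (hPs : Ps 0 = (C.attach ℓ).toKripke.pathOf ρ) :
    Sat (C.attach ℓ).toKripke AP' Ps (conj (alongLine sameBit sameBit)
    (conj
      (glob (conj (neg (atom 1 0))
        (conj (imp (atom 2 0) (alongLine verum (neg (atom 0 0))))
          (imp (atom 3 0) (alongLine verum (atom 0 0))))))
      (ev (atom 4 0)))) ↔
    (∀ j (hj : j < ℓ.length),
      (0 ∈ (C.attach ℓ).toKripke.label (ρ (1 + j)) ↔ ℓ[j] = true)) ∧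
    (∀ t, (ρ t).1 < C.size ∧
      (2 ∈ (C.attach ℓ).toKripke.label (ρ t) →
        0 ∉ (C.attach ℓ).toKripke.label (ρ (t + ℓ.length))) ∧
      (3 ∈ (C.attach ℓ).toKripke.label (ρ t) →
        0 ∈ (C.attach ℓ).toKripke.label (ρ (t + ℓ.length)))) ∧
    ∃ t, 4 ∈ (C.attach ℓ).toKripke.label (ρ t) := by
  have hN := List.length_pos_iff.2 hℓ
  rw [sat_conj, sat_conj, sat_glob, sat_ev]
  refine and_congr ?_ (and_congr (forall_congr' fun t => ?_) (exists_congr fun t => ?_))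
  · have hsame : ∀ π' : ℕ → Fin (C.size + ℓ.length),
      (∀ i ≤ ℓ.length, (π' (1 + i)).1 + 1 + i = C.size + ℓ.length) → ∀ i,
      i < ℓ.length → (Sat (C.attach ℓ).toKripke AP' (fun k t =>
      Fin.snoc (α := fun _ : Fin 2 => (C.attach ℓ).toKripke.Path) Ps
        ((C.attach ℓ).toKripke.pathOf π') k (1 + (i + t))) sameBit ↔ ∀ hi : i < ℓ.length,
          (0 ∈ (C.attach ℓ).toKripke.label (ρ (1 + i)) ↔ ℓ[i] = true)) := by
      intro π' hπ' i hi
      have h1 := line_bit_iff hi (hπ' i hi.le)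
      simp only [hi, forall_true_left]
      rw [← h1, sameBit, sat_conj, sat_imp, sat_imp, ← iff_def]
      change (0 ∈ (Ps 0 (1 + i)).2 ↔ _) ↔ _
      rw [hPs]
      exact Iff.rfl
    rw [sat_alongLine_iff hC hℓ hAP _ hsame hsame]
    · constructor
      · rintro ⟨h1, h2⟩ j hj
        rcases Nat.lt_or_ge j (ℓ.length - 1) with h | h
        · exact h2 j h hj
        · obtain rfl : j = ℓ.length - 1 := by omega
          exact h1 hj
      · intro h
        exact ⟨h _, fun j _ => h j⟩
    · rw [hPs]
      change (ρ 0).1 < _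
      rw [h0]
      exact C.start.2
  · rw [sat_conj]
    have h1 : Sat (C.attach ℓ).toKripke AP' (fun k i => Ps k (t + i)) (neg (atom 1 0)) ↔
        (ρ t).1 < C.size := by
      rw [← not_le, ← line_label_iff hC]
      change ¬ (1 ∈ (Ps 0 t).2) ↔ _
      rw [hPs]
      exact Iff.rfl
    rw [h1]
    refine and_congr_right fun h2 => ?_
    have h3 : ((fun k i => Ps k (t + i) : Fin 1 → (C.attach ℓ).toKripke.Path) 0 0).1.1
        < C.size := by
      simp only [hPs]
      exact h2
    rw [sat_conj, sat_imp, sat_imp, sat_late_iff hC hℓ hAP h3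
      (A := fun i => 0 ∉ (C.attach ℓ).toKripke.label (ρ (t + i))), sat_late_iff hC hℓ hAP h3
      (A := fun i => 0 ∈ (C.attach ℓ).toKripke.label (ρ (t + i)))]
    · change ((2 ∈ (Ps 0 t).2 → _) ∧ (3 ∈ (Ps 0 t).2 → _)) ↔ _
      rw [hPs]
      exact Iff.rfl
    · intro π' i
      change 0 ∈ (Ps 0 (t + i)).2 ↔ _
      rw [hPs]
      exact Iff.rfl
    · intro π' i
      change ¬ (0 ∈ (Ps 0 (t + i)).2) ↔ _
      rw [hPs]
      exact Iff.rfl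
  · change 4 ∈ (Ps 0 t).2 ↔ _
    rw [hPs]
    exact Iff.rfl

theorem mem_label_core_iff {s : Fin (C.size + ℓ.length)} (q : Fin C.size) (hs : s.1 = q.1)
    {a : ℕ} (ha : a < 5) : a ∈ (C.attach ℓ).toKripke.label s ↔ C.label q ⟨a, ha⟩ = true := by
  rw [mem_label_attach_iff ha]
  have h1 : s.1 < C.size := hs ▸ q.2
  simp only [attach, h1, dite_true]
  rw [show (⟨s.1, h1⟩ : Fin C.size) = q from Fin.ext hs]

/-- The attached structure satisfies the formula iff the core has an accepting run that obeys the
delay constraints. -/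
theorem attach_satisfies_iff (hC : ∀ q, C.label q 1 = false) (hℓ : ℓ ≠ []) (k : ℕ) :
    Satisfies (C.attach ℓ).toKripke (paddedFormula k) ↔
      ∃ ρ, C.IsDelayRun ℓ ρ ∧ ∃ t, C.label (ρ t) 4 = true := by
  have hN := List.length_pos_iff.2 hℓ
  have hAP : (paddedFormula k).atoms ⊆ (C.attach ℓ).toKripke.AP := atoms_paddedFormula k
  rw [Satisfies, sat_paddedFormula, delayFormula, Sat.eq_6, pathsExt_eq hAP, paths_eq_image,
    Set.exists_mem_image]
  constructor
  · rintro ⟨ρ, ⟨h1, h2⟩, h3⟩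
    rw [sat_delayFormula_body hC hℓ hAP h1 rfl] at h3
    obtain ⟨h3, h4, t, h5⟩ := h3
    have hm := fun {a : ℕ} (ha : a < 5) (t : ℕ) =>
      mem_label_core_iff (ℓ := ℓ) (s := ρ t) ⟨(ρ t).1, (h4 t).1⟩ rfl ha
    refine ⟨fun t => ⟨(ρ t).1, (h4 t).1⟩, ⟨Fin.ext (congrArg (Fin.val (n := C.size + ℓ.length)) h1), fun t => ?_,
      fun j hj => ?_, fun t ht => ?_, fun t ht => ?_⟩, t, (hm (by norm_num) t).1 h5⟩
    · have h6 : (C.attach ℓ).edge (ρ t) (ρ (t + 1)) = true := h2 t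
      have h7 := (h4 (t + 1)).1
      -- Among core states `attach` adds an edge to the last state only in case the line is empty,
      -- which is excluded here.
      have h8 : ¬ ((ρ (t + 1)).1 + 1 = C.size + ℓ.length) := by omega
      simpa only [attach, (h4 t).1, h7, h8, dite_true, decide_false, Bool.or_false] using h6
    · have h6 := (hm (by norm_num) _).symm.trans (h3 j hj)
      exact Bool.eq_iff_iff.2 h6
    · have h6 := (h4 t).2.1 ((hm (by norm_num) t).2 ht)
      rw [hm (by norm_num)] at h6
      exact Bool.eq_false_iff.2 h6
    · have h6 := (h4 t).2.2 ((hm (by norm_num) t).2 ht)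
      rwa [hm (by norm_num)] at h6
  · rintro ⟨ρ, hρ, t, ht⟩
    have hm := fun {a : ℕ} (ha : a < 5) (t : ℕ) =>
      mem_label_core_iff (ℓ := ℓ) (s := Fin.castAdd _ (ρ t)) (ρ t) rfl ha
    refine ⟨fun t => Fin.castAdd _ (ρ t), ⟨congrArg _ hρ.start, fun t => ?_⟩, ?_⟩
    · change (C.attach ℓ).edge _ _ = true
      simp [attach, hρ.edge]
    · rw [sat_delayFormula_body hC hℓ hAP (congrArg _ hρ.start) rfl]
      refine ⟨fun j hj => ?_, fun t => ⟨(ρ t).2, fun h => ?_, fun h => ?_⟩, t, ?_⟩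
      · rw [hm (by norm_num), ← hρ.initial j hj]
        exact Iff.rfl
      · rw [hm (by norm_num)] at h ⊢
        exact Bool.eq_false_iff.1 (hρ.out_false t h)
      · rw [hm (by norm_num)] at h ⊢
        exact hρ.out_true t h
      · exact (hm (by norm_num) t).2 ht

end Core

/-! ### Delay systems over a finite alphabet of cells -/

/-- A rule that computes a cell from three consecutive cells. -/
structure DelaySystem where
  Cell : Type
  [cellFin : Fintype Cell]
  wall : Bool → Cell
  window : Cell → Cell → Cell → Cell
  acc : Cell → Bool

namespace DelaySystem

variable (D : DelaySystem)

instance : Fintype D.Cell := D.cellFin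

/-- The sequences of cells that start with two walls and the cells `I`, and continue according to
the rule. -/
structure IsRun (I : List D.Cell) (c : ℕ → D.Cell) : Prop where
  zero : c 0 = D.wall false
  one : c 1 = D.wall true
  initial : ∀ i (hi : i < I.length), c (i + 2) = I[i]
  window : ∀ j, c (j + I.length + 2) = D.window (c j) (c (j + 1)) (c (j + 2))

/-- The number of bits that encode a cell. -/
abbrev width : ℕ := Fintype.card D.Cell

theorem width_pos : 0 < D.width := Fintype.card_pos_iff.2 ⟨D.wall false⟩

/-- The unary code of a cell. -/
noncomputable def code (a : D.Cell) (i : Fin D.width) : Bool :=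
  decide (Fintype.equivFin D.Cell a = i)

theorem code_injective : Function.Injective D.code := by
  intro a b h
  have := congrFun h (Fintype.equivFin D.Cell b)
  simpa [code] using this

/-- The bits that encode a word of cells. -/
noncomputable def bits (I : List D.Cell) : List Bool := I.flatMap fun a => List.ofFn (D.code a)

theorem length_bits (I : List D.Cell) : (D.bits I).length = I.length * D.width := by
  induction I with
  | nil => simp [bits]
  | cons a I ih =>
    simp only [bits, List.flatMap_cons, List.length_append, List.length_ofFn, List.length_cons]
      at ih ⊢
    rw [ih]; ring

theorem getElem?_bits (I : List D.Cell) (i : ℕ) (hi : i < I.length) (j : Fin D.width) :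
    (D.bits I)[i * D.width + j]? = some (D.code I[i] j) := by
  induction I generalizing i with
  | nil => simp at hi
  | cons a I ih =>
    simp only [bits, List.flatMap_cons] at ih ⊢
    cases i with
    | zero => simp [List.getElem?_append]
    | succ i =>
      rw [List.getElem?_append_right (by simp; nlinarith [j.2])]
      have h1 : (i + 1) * D.width + j - (List.ofFn (D.code a)).length = i * D.width + j := by
        simp; ring_nf; omega
      rw [h1, ih i (by simpa using hi)]
      simp

/-- The states of the core: the start state, or the window of three cells and the position in the
third cell. -/
abbrev CoreState : Type := Option (D.Cell × D.Cell × D.Cell × Fin D.width)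

/-- The edges of the core. -/
def CoreEdge : D.CoreState → D.CoreState → Prop
  | _, none => False
  | none, some (a, b, _, i) => a = D.wall false ∧ b = D.wall true ∧ i.1 = 0
  | some (a, b, c, i), some (a', b', c', i') =>
      (i'.1 = i.1 + 1 ∧ a' = a ∧ b' = b ∧ c' = c) ∨
        (i.1 + 1 = D.width ∧ i'.1 = 0 ∧ a' = b ∧ b' = c)

/-- The labels of the core. -/
noncomputable def coreLabel : D.CoreState → Fin 5 → Bool
  | none => fun _ => false
  | some (a, b, c, i) =>
      ![D.code c i, false, !D.code (D.window a b c) i, D.code (D.window a b c) i, D.acc c]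

open Classical in
/-- The core that guesses a sequence of cells, bit by bit. -/
noncomputable def core : Core where
  size := Fintype.card D.CoreState
  start := Fintype.equivFin D.CoreState none
  edge s t := decide (D.CoreEdge ((Fintype.equivFin D.CoreState).symm s)
    ((Fintype.equivFin D.CoreState).symm t))
  label s := D.coreLabel ((Fintype.equivFin D.CoreState).symm s)

theorem core_label_one (q : Fin D.core.size) : D.core.label q 1 = false := by
  simp only [core]
  rcases (Fintype.equivFin D.CoreState).symm q with _ | ⟨a, b, c, i⟩ <;> rfl

/-- The state at a time of the sequence of core states that belongs to a sequence of cells. -/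
def stateAt (c : ℕ → D.Cell) : ℕ → D.CoreState
  | 0 => none
  | t + 1 => some (c (t / D.width), c (t / D.width + 1), c (t / D.width + 2),
      ⟨t % D.width, Nat.mod_lt _ D.width_pos⟩)

theorem stateAt_eq (c : ℕ → D.Cell) (j : ℕ) (i : Fin D.width) :
    D.stateAt c (j * D.width + i + 1) = some (c j, c (j + 1), c (j + 2), i) := by
  have h1 : (j * D.width + i) / D.width = j := by
    rw [mul_comm, Nat.mul_add_div D.width_pos, Nat.div_eq_of_lt i.2, add_zero]
  have h2 : (j * D.width + i) % D.width = i := by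
    rw [mul_comm, Nat.mul_add_mod, Nat.mod_eq_of_lt i.2]
  simp only [stateAt, h1, h2]

/-- The start state has no incoming edge. The window is constant during a block of `width` steps and
then shifts by one cell, the new third cell being free. The cells are therefore read off at the
beginnings of the blocks. -/
theorem exists_stateAt {σ : ℕ → D.CoreState} (h0 : σ 0 = none)
    (h : ∀ t, D.CoreEdge (σ t) (σ (t + 1))) :
    ∃ c : ℕ → D.Cell, c 0 = D.wall false ∧ c 1 = D.wall true ∧ σ = D.stateAt c := by
  have hsome : ∀ t, ∃ q, σ (t + 1) = some q := fun t => by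
    rcases h1 : σ (t + 1) with _ | q
    · have := h t
      rw [h1] at this
      cases σ t <;> simp [CoreEdge] at this
    · exact ⟨q, rfl⟩
  choose q hq using hsome
  let c : ℕ → D.Cell
    | 0 => D.wall false
    | 1 => D.wall true
    | j + 2 => (q (j * D.width)).2.2.1
  have hrow : ∀ j, (q (j * D.width)) = (c j, c (j + 1), c (j + 2), ⟨0, D.width_pos⟩) →
      ∀ i : Fin D.width, q (j * D.width + i) = (c j, c (j + 1), c (j + 2), i) := by
    rintro j hj ⟨i, hi⟩
    induction i with
    | zero => exact hj
    | succ i ih =>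
      have h1 := h (j * D.width + i + 1)
      have h2 := ih (by omega)
      simp only at h2
      rw [hq, hq, h2] at h1
      rcases h3 : q (j * D.width + i + 1) with ⟨a', b', c', i'⟩
      rw [h3] at h1
      simp only [CoreEdge] at h1
      rcases h1 with ⟨h4, rfl, rfl, rfl⟩ | ⟨h4, _⟩
      · congr
        exact Fin.ext h4
      · omega
  have hall : ∀ j, (q (j * D.width)) = (c j, c (j + 1), c (j + 2), ⟨0, D.width_pos⟩) := by
    intro j
    induction j with
    | zero =>
      have h1 := h 0
      rw [h0, hq] at h1
      simp only [CoreEdge] at h1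
      rw [zero_mul]
      refine Prod.ext h1.1 (Prod.ext h1.2.1 (Prod.ext ?_ (Fin.ext h1.2.2)))
      simp [c]
    | succ j ih =>
      have h1 := hrow j ih ⟨D.width - 1, by have := D.width_pos; omega⟩
      have h2 := h (j * D.width + (D.width - 1) + 1)
      have h3 : j * D.width + (D.width - 1) + 1 = (j + 1) * D.width := by
        have := D.width_pos; rw [add_mul]; omega
      rw [hq, hq, h1, h3] at h2
      simp only [CoreEdge] at h2
      rcases h2 with ⟨h4, _⟩ | ⟨_, h4, h5, h6⟩
      · have := (q ((j + 1) * D.width)).2.2.2.2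
        have := D.width_pos
        omega
      · exact Prod.ext h5 (Prod.ext h6 (Prod.ext rfl (Fin.ext h4)))
  refine ⟨c, rfl, rfl, funext fun t => ?_⟩
  cases t with
  | zero => exact h0
  | succ t =>
    have h1 := hrow _ (hall (t / D.width)) ⟨t % D.width, Nat.mod_lt _ D.width_pos⟩
    simp only [Nat.div_add_mod'] at h1
    rw [hq, h1]
    rfl

theorem coreEdge_stateAt {c : ℕ → D.Cell} (h0 : c 0 = D.wall false) (h1 : c 1 = D.wall true)
    (t : ℕ) : D.CoreEdge (D.stateAt c t) (D.stateAt c (t + 1)) := by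
  cases t with
  | zero => simp [stateAt, CoreEdge, h0, h1]
  | succ t =>
    obtain ⟨j, i, rfl⟩ : ∃ (j : ℕ) (i : Fin D.width), t = j * D.width + i :=
      ⟨t / D.width, ⟨t % D.width, Nat.mod_lt _ D.width_pos⟩, (Nat.div_add_mod' _ _).symm⟩
    rw [stateAt_eq]
    by_cases hi : i.1 + 1 < D.width
    · have := D.stateAt_eq c j ⟨i.1 + 1, hi⟩
      simp only [← add_assoc] at this
      rw [this]
      simp [CoreEdge]
    · have := D.stateAt_eq c (j + 1) ⟨0, D.width_pos⟩
      have h2 : i.1 + 1 = D.width := by omega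
      have h3 : (j + 1) * D.width + 0 + 1 = j * D.width + i + 1 + 1 := by
        rw [add_mul]; omega
      simp only [h3] at this
      rw [this]
      exact Or.inr ⟨h2, rfl, rfl, rfl⟩

/-- A block of `width` states spells one cell, so the length of `bits I` is a delay of `I.length`
cells. Counted from the third cell `c (j + 2)` of the window, which is the one being spelled, it
leads to `c (j + I.length + 2)`, the cell that the rule computes. Outside the start state exactly
one of the propositions `2` and `3` holds, so every bit of that cell is fixed. -/
theorem exists_delayRun_iff (I : List D.Cell) :
    (∃ ρ, D.core.IsDelayRun (D.bits I) ρ ∧ ∃ t, D.core.label (ρ t) 4 = true) ↔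
      ∃ c, D.IsRun I c ∧ ∃ j, D.acc (c (j + 2)) = true := by
  let e := Fintype.equivFin D.CoreState
  have hlab : ∀ (c : ℕ → D.Cell) (ρ : ℕ → Fin D.core.size), (∀ t, e.symm (ρ t) = D.stateAt c t) →
      ∀ (j : ℕ) (i : Fin D.width), D.core.label (ρ (j * D.width + i + 1)) =
        ![D.code (c (j + 2)) i, false, !D.code (D.window (c j) (c (j + 1)) (c (j + 2))) i,
          D.code (D.window (c j) (c (j + 1)) (c (j + 2))) i, D.acc (c (j + 2))] := by
    intro c ρ hρ j i
    change D.coreLabel (e.symm (ρ _)) = _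
    rw [hρ, stateAt_eq]
    rfl
  have hsplit : ∀ t, ∃ (j : ℕ) (i : Fin D.width), t = j * D.width + i := fun t =>
      ⟨t / D.width, ⟨t % D.width, Nat.mod_lt _ D.width_pos⟩, (Nat.div_add_mod' _ _).symm⟩
  constructor
  · rintro ⟨ρ, hρ, t, ht⟩
    obtain ⟨c, h0, h1, h2⟩ := D.exists_stateAt (σ := fun t => e.symm (ρ t))
      (by rw [hρ.start]; exact e.symm_apply_apply _) (fun t => by simpa [core] using hρ.edge t)
    have hl := hlab c ρ (congrFun h2)
    refine ⟨c, ⟨h0, h1, fun j hj => ?_, fun j => ?_⟩, ?_⟩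
    · refine D.code_injective (funext fun i => ?_)
      have h3 : j * D.width + i < (D.bits I).length := by
        rw [length_bits]; nlinarith [i.2]
      have h4 := hρ.initial _ h3
      rw [add_comm 1, hl] at h4
      have h5 := D.getElem?_bits I j hj i
      rw [List.getElem?_eq_getElem h3, ← h4] at h5
      exact Option.some_injective _ h5
    · refine D.code_injective (funext fun i => ?_)
      have h3 := hρ.out_false (j * D.width + i + 1)
      have h4 := hρ.out_true (j * D.width + i + 1)
      have h5 : j * D.width + i + 1 + (D.bits I).length = (j + I.length) * D.width + i + 1 := by
        rw [length_bits]; ring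
      rw [h5, hl, hl] at h3 h4
      simp at h3 h4
      cases h6 : D.code (D.window (c j) (c (j + 1)) (c (j + 2))) i
      · exact h3 h6
      · exact h4 h6
    · cases t with
      | zero =>
        rw [hρ.start] at ht
        simp [core, coreLabel] at ht
      | succ t =>
        obtain ⟨j, i, rfl⟩ := hsplit t
        rw [hl] at ht
        exact ⟨j, ht⟩
  · rintro ⟨c, hc, j, hj⟩
    have h2 : ∀ t, e.symm (e (D.stateAt c t)) = D.stateAt c t := fun t => e.symm_apply_apply _
    have hl := hlab c (fun t => e (D.stateAt c t)) h2
    refine ⟨fun t => e (D.stateAt c t), ⟨rfl, fun t => ?_, fun t ht => ?_, fun t ht => ?_,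
      fun t ht => ?_⟩, j * D.width + (⟨0, D.width_pos⟩ : Fin D.width) + 1, ?_⟩
    · simp only [core, decide_eq_true_eq]
      rw [h2, h2]
      exact D.coreEdge_stateAt hc.zero hc.one t
    · obtain ⟨j, i, rfl⟩ := hsplit t
      have h3 : j < I.length := by
        rw [length_bits] at ht
        by_contra h
        have := Nat.mul_le_mul_right D.width (not_lt.1 h)
        omega
      have h5 := D.getElem?_bits I j h3 i
      rw [List.getElem?_eq_getElem ht, ← hc.initial j h3] at h5
      rw [Option.some_injective _ h5]
      simp only [add_comm 1]
      rw [hl]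
      rfl
    rotate_left 2
    · exact (congrFun (hl j ⟨0, D.width_pos⟩) 4).trans hj
    all_goals
      cases t with
      | zero => simp [stateAt, core, coreLabel, e] at ht
      | succ t =>
        obtain ⟨j, i, rfl⟩ := hsplit t
        have h5 : j * D.width + i + 1 + (D.bits I).length = (j + I.length) * D.width + i + 1 := by
          rw [length_bits]; ring
        simp only [h5]
        rw [hl] at ht ⊢
        simpa [hc.window] using ht

end DelaySystem

/-! ### Space-bounded machines as delay systems -/

/-- As `I` is nonempty, the three cells of a window come strictly before the cell that they
determine. -/
theorem DelaySystem.IsRun.unique {D : DelaySystem} {I : List D.Cell} (hI : I ≠ [])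
    {c c' : ℕ → D.Cell} (h : D.IsRun I c) (h' : D.IsRun I c') : c = c' := by
  have hN := List.length_pos_iff.2 hI
  funext j
  induction j using Nat.strong_induction_on with
  | _ j ih =>
    match j, ih with
    | 0, _ => rw [h.zero, h'.zero]
    | 1, _ => rw [h.one, h'.one]
    | j + 2, ih =>
      rcases lt_or_ge j I.length with hj | hj
      · rw [h.initial j hj, h'.initial j hj]
      · obtain ⟨i, rfl⟩ := Nat.exists_eq_add_of_le' hj
        rw [h.window, h'.window, ih i (by omega), ih (i + 1) (by omega), ih (i + 2) (by omega)]

namespace SpaceTM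

variable (M : SpaceTM)

instance : Fintype M.State := M.stateFin

instance : Fintype M.Sym := M.symFin

/-- The cells of a row: walls that separate the rows, and tape cells with the state of the machine
if it scans the cell. The wall `Sum.inl true` precedes the row in which the head is missing. -/
abbrev TapeCell : Type := Bool ⊕ (M.Sym × Option M.State)

/-- The final states. -/
def Final (q : M.State) : Prop := q = M.accept ∨ q = M.reject

open Classical in
/-- The symbol that replaces the contents of a cell. -/
noncomputable def written (s : M.Sym) : Option M.State → M.Sym
  | none => s
  | some q => if M.Final q then s else (M.trans q s).2.1

open Classical in
/-- The new state of the machine, if it leaves the cell in the given direction. -/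
noncomputable def leaving (d : Turing.Dir) : M.TapeCell → Option M.State
  | Sum.inr (s, some q) =>
      if M.Final q then none else if (M.trans q s).2.2 = d then some (M.trans q s).1 else none
  | _ => none

open Classical in
/-- The new state of the machine, if it stays on the cell; `wall` tells whether the cell is the
first one. -/
noncomputable def staying (wall : Bool) (s : M.Sym) : Option M.State → Option M.State
  | none => none
  | some q =>
      if M.Final q then some q
      else if (M.trans q s).2.2 = Turing.Dir.left ∧ wall = true then some (M.trans q s).1 else none

/-- The cell after one step, computed from the cell and its neighbors. -/
noncomputable def nextCell : M.TapeCell → M.TapeCell → M.TapeCell → M.TapeCell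
  | _, Sum.inl _, _ => Sum.inl false
  | Sum.inl true, Sum.inr (s, _), _ => Sum.inr (s, some M.start)
  | a, Sum.inr (s, q), c => Sum.inr (M.written s q,
      ((M.staying a.isLeft s q).or (M.leaving Turing.Dir.right a)).or
        (M.leaving Turing.Dir.left c))

open Classical in
/-- The delay system of a machine. -/
noncomputable abbrev delaySystem : DelaySystem where
  Cell := M.TapeCell
  wall := Sum.inl
  window := M.nextCell
  acc
    | Sum.inr (_, some q) => decide (q = M.accept)
    | _ => false

/-- The first row. -/
def firstRow (x : List Bool) (P : ℕ) : List M.TapeCell :=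
  x.map (fun b => Sum.inr (M.input b, none)) ++ List.replicate P (Sum.inr (M.blank, none))

/-- The cell at a position of a configuration. -/
def cellOf (c : M.Cfg) (i : ℕ) : M.TapeCell :=
  Sum.inr (c.tape i, if c.head = i then some c.state else none)

/-- The rows of the run on the input `x`, where position `0` is the wall. -/
noncomputable def row (x : List Bool) : ℕ → ℕ → M.TapeCell
  | 0, 0 => Sum.inl true
  | _ + 1, 0 => Sum.inl false
  | 0, i + 1 => Sum.inr ((M.initial x).tape i, none)
  | r + 1, i + 1 => M.cellOf (M.run x r) i

/-- The concatenation of the rows. -/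
noncomputable def rows (x : List Bool) (S : ℕ) : ℕ → M.TapeCell
  | 0 => Sum.inl false
  | j + 1 => M.row x (j / (S + 1)) (j % (S + 1))

/-! ### The rows of a computation obey the delay rule -/

variable {M}

theorem run_succ (x : List Bool) (t : ℕ) : M.run x (t + 1) = M.step (M.run x t) :=
  Function.iterate_succ_apply' _ _ _

theorem rows_eq (x : List Bool) (S r k : ℕ) (hk : k ≤ S) :
    M.rows x S (r * (S + 1) + k + 1) = M.row x r k := by
  have h1 : (r * (S + 1) + k) / (S + 1) = r := by
    rw [mul_comm, Nat.mul_add_div (Nat.succ_pos _), Nat.div_eq_of_lt (by omega), add_zero]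
  have h2 : (r * (S + 1) + k) % (S + 1) = k := by
    rw [mul_comm, Nat.mul_add_mod, Nat.mod_eq_of_lt (by omega)]
  simp only [rows, h1, h2]

open Classical in
-- Only the positions `i - 1`, `i` and `i + 1` of the head can influence cell `i`, which gives the
-- case distinction. A wall may replace the right neighbor as long as it hides no head.
theorem nextCell_cellOf (c : M.Cfg) (i : ℕ) {a b : M.TapeCell}
    (ha : a = if i = 0 then Sum.inl false else M.cellOf c (i - 1))
    (hb : b = M.cellOf c (i + 1) ∨ (∃ w, b = Sum.inl w) ∧ c.head ≤ i) :
    M.nextCell a (M.cellOf c i) b = M.cellOf (M.step c) i := by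
  have hb' : M.leaving Turing.Dir.left b =
      if c.head = i + 1 then M.leaving Turing.Dir.left (M.cellOf c (i + 1)) else none := by
    rcases hb with rfl | ⟨⟨w, rfl⟩, h⟩
    · split_ifs with h
      · rfl
      · simp [cellOf, leaving, h]
    · rw [if_neg (by omega)]
      rfl
  have ha' : M.nextCell a (M.cellOf c i) b = Sum.inr (M.written (c.tape i)
      (if c.head = i then some c.state else none),
      ((M.staying (decide (i = 0)) (c.tape i) (if c.head = i then some c.state else none)).or
        (M.leaving Turing.Dir.right a)).or (M.leaving Turing.Dir.left b)) := by
    rcases i with _ | i <;> subst ha <;> simp [nextCell, cellOf]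
  have ha'' : M.leaving Turing.Dir.right a =
      if c.head + 1 = i then M.leaving Turing.Dir.right (M.cellOf c (i - 1)) else none := by
    rcases i with _ | i <;> subst ha
    · rfl
    · simp only [Nat.add_eq_zero_iff, one_ne_zero, and_false, if_false, Nat.add_sub_cancel,
        Nat.add_right_cancel_iff]
      split_ifs with h
      · rfl
      · simp [cellOf, leaving, h]
  have hl : ∀ d i, c.head = i → M.leaving d (M.cellOf c i) = if M.Final c.state then none else
      if (M.trans c.state (c.tape i)).2.2 = d then some (M.trans c.state (c.tape i)).1
      else none := by
    rintro d i rfl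
    simp [cellOf, leaving]
  rw [ha', ha'', hb']
  by_cases hf : M.Final c.state
  · have hs : M.step c = c := if_pos hf
    rw [hs]
    have h1 : ∀ d i, (if c.head = i then M.leaving d (M.cellOf c i) else none) = none := by
      intro d i
      split_ifs with h
      · rw [hl d i h, if_pos hf]
      · rfl
    have h2 : (if c.head + 1 = i then M.leaving Turing.Dir.right (M.cellOf c (i - 1)) else none) =
        none := by
      split_ifs with h
      · rw [hl _ (i - 1) (by omega), if_pos hf]
      · rfl
    rw [h1, h2]
    by_cases h : c.head = i <;> simp [cellOf, h, written, staying, hf]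
  · have hs : M.step c = _ := if_neg hf
    rw [hs]
    by_cases h1 : c.head = i
    · have h2 : ¬ c.head + 1 = i := by omega
      have h3 : ¬ c.head = i + 1 := by omega
      rw [if_neg h2, if_neg h3, if_pos h1]
      subst h1
      simp only [cellOf, written, staying, if_neg hf, Function.update_self, Option.or_none]
      rcases (M.trans c.state (c.tape c.head)).2.2 with _ | _
      · by_cases h4 : c.head = 0
        · simp [h4]
        · have h5 : ¬ c.head - 1 = c.head := by omega
          simp [h4, h5]
      · simp
    · by_cases h2 : c.head + 1 = i
      · have h3 : ¬ c.head = i + 1 := by omega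
        rw [if_pos h2, if_neg h3, if_neg h1, hl _ (i - 1) (by omega), if_neg hf]
        subst h2
        simp only [cellOf, written, staying, Nat.add_sub_cancel, Option.or_none, Option.none_or]
        rcases (M.trans c.state (c.tape c.head)).2.2 with _ | _
        · have h4 : ¬ c.head - 1 = c.head + 1 := by omega
          simp [h4]
        · simp
      · by_cases h3 : c.head = i + 1
        · rw [if_neg h2, if_pos h3, if_neg h1, hl _ _ h3, if_neg hf]
          simp only [cellOf, written, staying, Option.none_or]
          rw [Function.update_of_ne (Ne.symm h1), ← h3]
          rcases (M.trans c.state (c.tape c.head)).2.2 with _ | _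
          · simp [h3]
          · have h4 : ¬ c.head + 1 = i := by omega
            simp [h4]
        · rw [if_neg h2, if_neg h3, if_neg h1]
          simp only [cellOf, written, staying, Option.none_or]
          rw [Function.update_of_ne (Ne.symm h1), if_neg]
          rcases (M.trans c.state (c.tape c.head)).2.2 with _ | _ <;> simp only <;> omega

theorem length_firstRow (x : List Bool) (P : ℕ) : (M.firstRow x P).length = x.length + P := by
  simp [firstRow]

/-- Row `0` has no head; its special wall `Sum.inl true` makes the rule place the start state on the
first cell of row `1`. Row `r + 1` is thus the configuration at time `r`. Because of this delay the
first row is a letter-by-letter image of the input followed by blanks. -/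
theorem nextCell_row {x : List Bool} {S : ℕ} (hS : ∀ t, (M.run x t).head < S) (r i : ℕ)
    {b : M.TapeCell} (hi : i < S)
    (hb : b = M.row x r (i + 2) ∨ (∃ w, b = Sum.inl w) ∧ i + 1 = S) :
    M.nextCell (M.row x r i) (M.row x r (i + 1)) b = M.row x (r + 1) (i + 1) := by
  cases r with
  | zero =>
    have hb' : M.leaving Turing.Dir.left b = none := by
      rcases hb with rfl | ⟨⟨w, rfl⟩, _⟩ <;> rfl
    cases i with
    | zero => simp [row, nextCell, cellOf, run, initial]
    | succ i =>
      simp only [row, nextCell, hb', staying, written]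
      simp [leaving, cellOf, run, initial]
  | succ r =>
    have h := hS r
    simp only [row]
    rw [run_succ]
    refine nextCell_cellOf _ _ ?_ ?_
    · cases i <;> simp
    · rcases hb with rfl | ⟨h1, h2⟩
      · exact Or.inl rfl
      · exact Or.inr ⟨h1, by omega⟩

/-- A row consists of a wall and `S` cells, so the cell below `c (j + 1)`, the middle of the window,
is `c (j + 1 + (S + 1))`. This is the position `j + S + 2` of the rule. The wall at position `0`
only completes the first window. -/
theorem isRun_rows {x : List Bool} {P : ℕ} (hS : ∀ t, (M.run x t).head < x.length + P) :
    M.delaySystem.IsRun (M.firstRow x P) (M.rows x (x.length + P)) := by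
  refine ⟨rfl, ?_, fun i hi => ?_, fun j => ?_⟩
  · have := rows_eq (M := M) x (x.length + P) 0 0 (Nat.zero_le _)
    simpa [row] using this
  · have hi' := hi
    rw [length_firstRow] at hi'
    have := rows_eq (M := M) x (x.length + P) 0 (i + 1) (by omega)
    rw [zero_mul, zero_add] at this
    rw [this]
    rcases lt_or_ge i x.length with h | h
    · simp [row, initial, firstRow, h]
    · simp [row, initial, firstRow, List.getElem_append_right, h]
  · rw [length_firstRow]
    set S := x.length + P
    obtain ⟨r, k, hk, rfl⟩ : ∃ r k, k ≤ S ∧ j = r * (S + 1) + k :=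
      ⟨j / (S + 1), j % (S + 1), Nat.le_of_lt_succ (Nat.mod_lt _ (Nat.succ_pos _)),
        (Nat.div_add_mod' _ _).symm⟩
    have h1 : r * (S + 1) + k + S + 2 = (r + 1) * (S + 1) + k + 1 := by ring
    rw [h1, rows_eq x S _ _ hk, rows_eq x S _ _ hk]
    change _ = M.nextCell _ _ _
    cases k with
    | zero =>
      cases r <;> rfl
    | succ i =>
      have h2 := rows_eq (M := M) x S r i (by omega)
      rw [← add_assoc, h2]
      refine (nextCell_row hS r i (by omega) ?_).symm
      rcases Nat.lt_or_ge (i + 1) S with h3 | h3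
      · exact Or.inl (rows_eq x S r (i + 2) (by omega))
      · have h4 : i + 1 = S := by omega
        -- To the right of the last cell of a row stands the wall of the next row.
        refine Or.inr ⟨?_, h4⟩
        have h5 : r * (S + 1) + i + 1 + 2 = (r + 1) * (S + 1) + 0 + 1 := by
          rw [add_mul]; omega
        rw [h5, rows_eq x S _ _ (Nat.zero_le _)]
        exact ⟨false, rfl⟩

theorem exists_accepting_run_iff {x : List Bool} {P : ℕ}
    (hS : ∀ t, (M.run x t).head < x.length + P) :
    (∃ c, M.delaySystem.IsRun (M.firstRow x P) c ∧
      ∃ j, M.delaySystem.acc (c (j + 2)) = true) ↔ ∃ t, (M.run x t).state = M.accept := by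
  have hI : M.firstRow x P ≠ [] := by
    rw [← List.length_pos_iff, length_firstRow]
    exact (Nat.zero_le _).trans_lt (hS 0)
  constructor
  · rintro ⟨c, hc, j, hj⟩
    rw [hc.unique hI (isRun_rows hS)] at hj
    simp only [rows] at hj
    revert hj
    rcases (j + 1) / (x.length + P + 1) with _ | r <;>
    rcases (j + 1) % (x.length + P + 1) with _ | i
    · simp [row]
    · simp [row]
    · simp [row]
    · intro hj
      by_cases h : (M.run x r).head = i
      · exact ⟨r, by simpa [row, cellOf, h] using hj⟩
      · simp [row, cellOf, h] at hj
  · rintro ⟨t, ht⟩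
    -- The configuration at time `t` fills row `t + 1`; the offset `2` in `acc (c (j + 2))` skips
    -- the initial extra wall and the wall of the row.
    refine ⟨_, isRun_rows hS, (t + 1) * (x.length + P + 1) + (M.run x t).head, ?_⟩
    have h1 := hS t
    have h2 := rows_eq (M := M) x (x.length + P) (t + 1) ((M.run x t).head + 1) (by omega)
    rw [← add_assoc] at h2
    rw [h2]
    simp [row, cellOf, ht]

theorem final_stable {x : List Bool} {t : ℕ} (h : M.Final (M.run x t).state) (i : ℕ) :
    M.run x (t + i) = M.run x t := by
  induction i with
  | zero => rfl
  | succ i ih =>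
    rw [← add_assoc, run_succ, ih]
    exact if_pos h

/-- Final configurations are stable, so a run cannot both accept and reject. -/
theorem DecidesInSpace.mem_iff {L : Language Bool} {s : ℕ → ℕ} (h : M.DecidesInSpace L s)
    (x : List Bool) : x ∈ L ↔ ∃ t, (M.run x t).state = M.accept := by
  refine ⟨(h x).1, fun ⟨t, ht⟩ => ?_⟩
  by_contra hx
  obtain ⟨t', ht'⟩ := (h x).2.1 hx
  have h1 := final_stable (Or.inl ht) t'
  have h2 := final_stable (Or.inr ht') t
  rw [add_comm, h1] at h2
  rw [← h2, ht] at ht'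
  exact M.accept_ne_reject ht'

end SpaceTM

/-! ### A loop language for stacks of bits -/

/-- Programs over stacks of bits. The command `loop k f` removes the top `b` of the stack `k` and
runs `f b`, until the stack is empty. -/
inductive Cmd (κ : Type) : Type
  | push (k : κ) (l : List Bool) : Cmd κ
  | pop (k : κ) : Cmd κ
  | seq (c d : Cmd κ) : Cmd κ
  | loop (k : κ) (f : Bool → Cmd κ) : Cmd κ

namespace Cmd

open Turing Function

variable {κ : Type} [DecidableEq κ]

/-- The contents of the stacks. -/
abbrev Store (κ : Type) : Type := κ → List Bool

/-- `Run c s n s'` says that `c` changes `s` to `s'` in `n` steps. -/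
inductive Run : Cmd κ → Store κ → ℕ → Store κ → Prop
  | push (k : κ) (l : List Bool) (s : Store κ) : Run (push k l) s 1 (update s k (l ++ s k))
  | pop (k : κ) (s : Store κ) : Run (pop k) s 1 (update s k (s k).tail)
  | seq {c d : Cmd κ} {s s' s'' : Store κ} {n n' : ℕ} :
      Run c s n s' → Run d s' n' s'' → Run (seq c d) s (n' + n) s''
  | done {k : κ} {f : Bool → Cmd κ} {s : Store κ} : s k = [] → Run (loop k f) s 1 s
  | iter {k : κ} {f : Bool → Cmd κ} {s s' s'' : Store κ} {b : Bool} {l : List Bool} {n n' : ℕ} :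
      s k = b :: l → Run (f b) (update s k l) n s' → Run (loop k f) s' n' s'' →
      Run (loop k f) s (n' + (n + 1)) s''

/-- The labels of the machine that runs a program. -/
def Label : Cmd κ → Type
  | push _ _ => Unit
  | pop _ => Unit
  | seq c d => c.Label ⊕ d.Label
  | loop _ f => Option (Σ b, (f b).Label)

/-- There are finitely many labels. -/
@[reducible]
def labelFintype : (c : Cmd κ) → Fintype c.Label
  | push _ _ => inferInstanceAs (Fintype Unit)
  | pop _ => inferInstanceAs (Fintype Unit)
  | seq c d =>
    letI := c.labelFintype
    letI := d.labelFintype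
    inferInstanceAs (Fintype (c.Label ⊕ d.Label))
  | loop _ f =>
    letI := fun b => (f b).labelFintype
    inferInstanceAs (Fintype (Option (Σ b, (f b).Label)))

/-- The first label. -/
def entry : (c : Cmd κ) → c.Label
  | push _ _ => ()
  | pop _ => ()
  | seq c _ => Sum.inl c.entry
  | loop _ _ => none

/-- The statement that pushes a word. -/
def pushWord {Λ : Type} (k : κ) (q : TM2.Stmt (fun _ : κ => Bool) Λ (Option Bool)) :
    List Bool → TM2.Stmt (fun _ : κ => Bool) Λ (Option Bool)
  | [] => q
  | b :: l => pushWord k (TM2.Stmt.push k (fun _ => b) q) l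

/-- The statements of the machine that runs a program as a part of a larger machine. -/
def stmt {Λ : Type} : (c : Cmd κ) → (c.Label → Λ) → Λ → c.Label →
    TM2.Stmt (fun _ : κ => Bool) Λ (Option Bool)
  | push k l, _, exit, _ => pushWord k (TM2.Stmt.goto fun _ => exit) l
  | pop k, _, exit, _ => TM2.Stmt.pop k (fun _ _ => none) (TM2.Stmt.goto fun _ => exit)
  | seq c d, e, _, Sum.inl x => c.stmt (fun y => e (Sum.inl y)) (e (Sum.inr d.entry)) x
  | seq _ d, e, exit, Sum.inr x => d.stmt (fun y => e (Sum.inr y)) exit x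
  | loop k f, e, exit, none => TM2.Stmt.pop k (fun _ o => o) (TM2.Stmt.branch Option.isSome
      (TM2.Stmt.goto fun v => e (some ⟨v.getD false, (f (v.getD false)).entry⟩))
      (TM2.Stmt.goto fun _ => exit))
  | loop _ f, e, _, some ⟨b, x⟩ => (f b).stmt (fun y => e (some ⟨b, y⟩)) (e none) x

theorem stepAux_pushWord {Λ : Type} (k : κ) (l : List Bool)
    (q : TM2.Stmt (fun _ : κ => Bool) Λ (Option Bool)) (v : Option Bool) (s : Store κ) :
    TM2.stepAux (pushWord k q l) v s = TM2.stepAux q v (update s k (l ++ s k)) := by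
  induction l generalizing q s with
  | nil => simp [pushWord]
  | cons b l ih => simp [pushWord, ih]

/-- The step counts coincide exactly. The surrounding machine, the embedding of the labels and the
exit are arbitrary, so the induction can place subprograms inside larger ones. The register is
arbitrary on entry because a loop overwrites it before testing it. -/
theorem Run.reaches {c : Cmd κ} {s s' : Store κ} {n : ℕ} (h : Run c s n s') {Λ : Type}
    {m : Λ → TM2.Stmt (fun _ : κ => Bool) Λ (Option Bool)} {e : c.Label → Λ} {exit : Λ}
    (hm : ∀ x, m (e x) = c.stmt e exit x) (v : Option Bool) :
    ∃ v', (flip bind (TM2.step m))^[n] (some ⟨some (e c.entry), v, s⟩) =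
      some ⟨some exit, v', s'⟩ := by
  induction h generalizing v exit with
  | push k l s =>
    refine ⟨v, ?_⟩
    change some (TM2.stepAux (m (e _)) v s) = _
    rw [hm, stmt, stepAux_pushWord]
    rfl
  | pop k s =>
    refine ⟨none, ?_⟩
    change some (TM2.stepAux (m (e _)) v s) = _
    rw [hm, stmt]
    rfl
  | seq _ _ ih1 ih2 =>
    obtain ⟨v1, h1⟩ := ih1 (fun x => hm (Sum.inl x)) v
    obtain ⟨v2, h2⟩ := ih2 (fun x => hm (Sum.inr x)) v1
    refine ⟨v2, ?_⟩
    rw [iterate_add_apply]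
    exact (congrArg _ h1).trans h2
  | @done k f s hs =>
    refine ⟨none, ?_⟩
    change some (TM2.stepAux (m (e _)) v s) = _
    have h1 : update s k (s k).tail = s := by
      rw [hs, List.tail_nil, ← hs, update_eq_self]
    rw [hm, entry, stmt]
    simp only [TM2.stepAux, hs, List.head?_nil, Option.isSome_none, cond_false]
    rw [hs] at h1
    rw [h1]
  | @iter k f s s' s'' b l n n' hs _ _ ih1 ih2 =>
    obtain ⟨v1, h1⟩ := ih1 (e := fun y => e (some ⟨b, y⟩)) (fun x => hm (some ⟨b, x⟩)) (some b)
    obtain ⟨v2, h2⟩ := ih2 hm v1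
    refine ⟨v2, ?_⟩
    rw [iterate_add_apply, iterate_add_apply, iterate_one]
    have h3 : flip bind (TM2.step m) (some ⟨some (e (loop k f).entry), v, s⟩) =
        some ⟨some (e (some ⟨b, (f b).entry⟩)), some b, update s k l⟩ := by
      change some (TM2.stepAux (m (e _)) v s) = _
      rw [hm, entry, stmt]
      simp [hs]
    rw [h3]
    exact (congrArg _ h1).trans h2

/-- The machine that runs a program. -/
def machine [Fintype κ] (c : Cmd κ) (k₀ k₁ : κ) : FinTM2 :=
  letI := c.labelFintype
  { K := κ
    k₀ := k₀
    k₁ := k₁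
    Γ := fun _ => Bool
    Λ := Option c.Label
    main := some c.entry
    σ := Option Bool
    initialState := none
    m := fun l => match l with
      | none => TM2.Stmt.load (fun _ => none) TM2.Stmt.halt
      | some x => c.stmt some none x }

/-- The store with a single nonempty stack. -/
def single (k : κ) (l : List Bool) : Store κ := update (fun _ => []) k l

theorem stack_eq_single (k₀ : κ) (l : List Bool) :
    (fun k : κ => @dite (List Bool) (k = k₀) _ (fun _ => l) fun _ => []) = single k₀ l := by
  funext k
  by_cases hk : k = k₀
  · subst hk
    simp [single]
  · simp [single, hk]

theorem polyTime_of_run [Fintype κ] {α : Type} {ea : α → List Bool} {β : Type}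
    {eb : β → List Bool} {f : α → β} (c : Cmd κ) (k₀ k₁ : κ) (T : Polynomial ℕ)
    (h : ∀ a, ∃ n ≤ T.eval (ea a).length, Run c (single k₀ (ea a)) n (single k₁ (eb (f a)))) :
    Nonempty (TM2ComputableInPolyTime ea eb f) := by
  have hout : ∀ a, ∃ n ≤ (T + 1).eval (ea a).length,
      (flip bind (c.machine k₀ k₁).step)^[n] (some (initList (c.machine k₀ k₁) (ea a))) =
        some (haltList (c.machine k₀ k₁) (eb (f a))) := by
    intro a
    obtain ⟨n, hn, hr⟩ := h a
    obtain ⟨v, hv⟩ := hr.reaches (m := (c.machine k₀ k₁).m) (e := some) (exit := none)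
      (fun x => rfl) none
    -- The additional step restores the register, as `haltList` prescribes, and halts.
    refine ⟨1 + n, by simp only [Polynomial.eval_add, Polynomial.eval_one]; omega, ?_⟩
    have h1 : initList (c.machine k₀ k₁) (ea a) =
        ⟨some (some c.entry), none, single k₀ (ea a)⟩ := by
      simp only [initList, single]
      congr 1
      exact stack_eq_single k₀ _
    have h2 : haltList (c.machine k₀ k₁) (eb (f a)) = ⟨none, none, single k₁ (eb (f a))⟩ := by
      simp only [haltList, single]
      congr 1
      exact stack_eq_single k₁ _
    rw [h1, h2, iterate_add_apply]
    exact (congrArg _ hv).trans rfl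
  choose steps hsteps hrun using hout
  exact ⟨{ tm := c.machine k₀ k₁
           inputAlphabet := Equiv.refl Bool
           outputAlphabet := Equiv.refl Bool
           time := T + 1
           outputsFun := fun a =>
            { steps := steps a
              evals_in_steps := (congrArg (fun l => (flip bind (c.machine k₀ k₁).step)^[steps a]
                (some (initList (c.machine k₀ k₁) l))) (List.map_id (ea a))).trans
                ((hrun a).trans (congrArg (fun l => some (haltList (c.machine k₀ k₁) l))
                  (List.map_id (eb (f a))).symm))
              steps_le_m := hsteps a } }⟩

end Cmd

/-! ### The program that writes the attached structure -/

namespace Cmd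

open Function

/-! ### Running times and loop invariants -/

section Runs

variable {κ : Type} [DecidableEq κ]

/-- `Runs c s T s'` says that `c` changes `s` to `s'` in at most `T` steps. -/
def Runs (c : Cmd κ) (s : Store κ) (T : ℕ) (s' : Store κ) : Prop := ∃ n ≤ T, Run c s n s'

theorem Runs.mono {c : Cmd κ} {s s' : Store κ} {T T' : ℕ} (h : Runs c s T s') (hT : T ≤ T') :
    Runs c s T' s' :=
  let ⟨n, hn, hr⟩ := h
  ⟨n, hn.trans hT, hr⟩

theorem runs_push {k : κ} {l : List Bool} {s s' : Store κ} (h : update s k (l ++ s k) = s') :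
    Runs (push k l) s 1 s' :=
  ⟨1, le_rfl, h ▸ Run.push k l s⟩

theorem runs_pop {k : κ} {s s' : Store κ} (h : update s k (s k).tail = s') :
    Runs (pop k) s 1 s' :=
  ⟨1, le_rfl, h ▸ Run.pop k s⟩

theorem Runs.seq {c d : Cmd κ} {s s' s'' : Store κ} {T T' : ℕ} (h : Runs c s T s')
    (h' : Runs d s' T' s'') : Runs (seq c d) s (T + T') s'' :=
  let ⟨_, hn, hr⟩ := h
  let ⟨_, hn', hr'⟩ := h'
  ⟨_, by omega, Run.seq hr hr'⟩

/-- The stores `G d r` describe a loop over a word, where `d` is the part that was read already,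
and `r` is the rest. -/
theorem runs_loop {k : κ} {f : Bool → Cmd κ} {L : List Bool} {T : ℕ}
    (G : List Bool → List Bool → Store κ) (hk : ∀ d r, G d r k = r)
    (h : ∀ d b r, d ++ b :: r = L → Runs (f b) (update (G d (b :: r)) k r) T (G (d ++ [b]) r)) :
    Runs (loop k f) (G [] L) ((T + 1) * L.length + 1) (G L []) := by
  suffices ∀ r d, d ++ r = L → Runs (loop k f) (G d r) ((T + 1) * r.length + 1) (G L []) from
    this L [] rfl
  intro r
  induction r with
  | nil =>
    intro d hd
    rw [List.append_nil] at hd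
    subst hd
    exact ⟨1, by simp, Run.done (hk _ _)⟩
  | cons b r ih =>
    intro d hd
    obtain ⟨n, hn, hr⟩ := h d b r hd
    obtain ⟨n', hn', hr'⟩ := ih (d ++ [b]) (by simpa using hd)
    refine ⟨_, ?_, Run.iter (hk _ _) hr hr'⟩
    simp only [List.length_cons]
    nlinarith

/-- The unary representation of a number. -/
abbrev unary (n : ℕ) : List Bool := List.replicate n true

/-- A word of zeros. -/
abbrev zeroWord (n : ℕ) : List Bool := List.replicate n false

/-- The stores `G d r` describe a loop over a number, where `d` counts the iterations that were
made already, and `r` the others. -/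
theorem runs_loop_unary {k : κ} {f : Bool → Cmd κ} {n : ℕ} {T : ℕ}
    (G : ℕ → ℕ → Store κ) (hk : ∀ d r, G d r k = unary r)
    (h : ∀ d r, d + (r + 1) = n → Runs (f true) (update (G d (r + 1)) k (unary r)) T
      (G (d + 1) r)) :
    Runs (loop k f) (G 0 n) ((T + 1) * n + 1) (G n 0) := by
  suffices ∀ r d, d + r = n → Runs (loop k f) (G d r) ((T + 1) * r + 1) (G n 0) from
    this n 0 (Nat.zero_add n)
  intro r
  induction r with
  | zero =>
    intro d hd
    rw [Nat.add_zero] at hd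
    subst hd
    exact ⟨1, by simp, Run.done (hk _ _)⟩
  | succ r ih =>
    intro d hd
    obtain ⟨n, hn, hr⟩ := h d r hd
    obtain ⟨n', hn', hr'⟩ := ih (d + 1) (by omega)
    refine ⟨_, ?_, Run.iter (hk _ _) hr hr'⟩
    nlinarith

end Runs

/-- The store with the given stacks: the input, a scratch stack, three counters, the number of
rows that were written and the number of rows to write, and the output. -/
def st (inp tmp cnt acc aux up down out : List Bool) : Store (Fin 8) :=
  ![inp, tmp, cnt, acc, aux, up, down, out]

section st

variable (inp tmp cnt acc aux up down out v : List Bool)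

@[simp] theorem st_zero : st inp tmp cnt acc aux up down out 0 = inp := rfl
@[simp] theorem st_one : st inp tmp cnt acc aux up down out 1 = tmp := rfl
@[simp] theorem st_two : st inp tmp cnt acc aux up down out 2 = cnt := rfl
@[simp] theorem st_three : st inp tmp cnt acc aux up down out 3 = acc := rfl
@[simp] theorem st_four : st inp tmp cnt acc aux up down out 4 = aux := rfl
@[simp] theorem st_five : st inp tmp cnt acc aux up down out 5 = up := rfl
@[simp] theorem st_six : st inp tmp cnt acc aux up down out 6 = down := rfl
@[simp] theorem st_seven : st inp tmp cnt acc aux up down out 7 = out := rfl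

@[simp] theorem update_st_zero : update (st inp tmp cnt acc aux up down out) 0 v =
    st v tmp cnt acc aux up down out := by funext i; fin_cases i <;> rfl
@[simp] theorem update_st_one : update (st inp tmp cnt acc aux up down out) 1 v =
    st inp v cnt acc aux up down out := by funext i; fin_cases i <;> rfl
@[simp] theorem update_st_two : update (st inp tmp cnt acc aux up down out) 2 v =
    st inp tmp v acc aux up down out := by funext i; fin_cases i <;> rfl
@[simp] theorem update_st_three : update (st inp tmp cnt acc aux up down out) 3 v =
    st inp tmp cnt v aux up down out := by funext i; fin_cases i <;> rfl
@[simp] theorem update_st_four : update (st inp tmp cnt acc aux up down out) 4 v =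
    st inp tmp cnt acc v up down out := by funext i; fin_cases i <;> rfl
@[simp] theorem update_st_five : update (st inp tmp cnt acc aux up down out) 5 v =
    st inp tmp cnt acc aux v down out := by funext i; fin_cases i <;> rfl
@[simp] theorem update_st_six : update (st inp tmp cnt acc aux up down out) 6 v =
    st inp tmp cnt acc aux up v out := by funext i; fin_cases i <;> rfl
@[simp] theorem update_st_seven : update (st inp tmp cnt acc aux up down out) 7 v =
    st inp tmp cnt acc aux up down v := by funext i; fin_cases i <;> rfl

end st

/-- Write as many zeros as the counter `k` says. -/
def zeros (k : Fin 8) : Cmd (Fin 8) :=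
  seq (loop k fun _ => seq (push 7 [false]) (push 1 [true])) (loop 1 fun _ => push k [true])

theorem runs_zeros_up (inp cnt acc aux down out : List Bool) (u : ℕ) :
    Runs (zeros 5) (st inp [] cnt acc aux (unary u) down out) (5 * u + 2)
      (st inp [] cnt acc aux (unary u) down (zeroWord u ++ out)) := by
  have h1 := runs_loop_unary (k := 5) (f := fun _ => seq (push 7 [false]) (push 1 [true])) (n := u)
    (T := 1 + 1) (fun d r => st inp (unary d) cnt acc aux (unary r) down (zeroWord d ++ out))
    (fun d r => rfl) (fun d r _ => Runs.seq (runs_push rfl) (runs_push (by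
      simp [unary, zeroWord, List.replicate_succ])))
  have h2 := runs_loop_unary (k := 1) (f := fun _ => push 5 [true]) (n := u) (T := 1)
    (fun d r => st inp (unary r) cnt acc aux (unary d) down (zeroWord u ++ out))
    (fun d r => rfl) (fun d r _ => runs_push (by simp [unary, List.replicate_succ]))
  exact (h1.seq h2).mono (by omega)

theorem runs_zeros_down (inp cnt acc aux up out : List Bool) (u : ℕ) :
    Runs (zeros 6) (st inp [] cnt acc aux up (unary u) out) (5 * u + 2)
      (st inp [] cnt acc aux up (unary u) (zeroWord u ++ out)) := by
  have h1 := runs_loop_unary (k := 6) (f := fun _ => seq (push 7 [false]) (push 1 [true])) (n := u)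
    (T := 1 + 1) (fun d r => st inp (unary d) cnt acc aux up (unary r) (zeroWord d ++ out))
    (fun d r => rfl) (fun d r _ => Runs.seq (runs_push rfl) (runs_push (by
      simp [unary, zeroWord, List.replicate_succ])))
  have h2 := runs_loop_unary (k := 1) (f := fun _ => push 6 [true]) (n := u) (T := 1)
    (fun d r => st inp (unary r) cnt acc aux up (unary d) (zeroWord u ++ out))
    (fun d r => rfl) (fun d r _ => runs_push (by simp [unary, List.replicate_succ]))
  exact (h1.seq h2).mono (by omega)

/-- The row of a state of the line with the bit `b`: it has an edge to the state number `d`, and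
`u + 1` larger states. -/
def lineRow (d u : ℕ) (b : Bool) : List Bool :=
  List.ofFn (Core.lineLabel b) ++ (zeroWord d ++ true :: zeroWord (u + 1))

/-- The rows of a part of the line that carries the given word. -/
def lineRows (d : ℕ) : ℕ → List Bool → List Bool
  | _, [] => []
  | u, b :: l => lineRows d (u + 1) l ++ lineRow (l.length + d) u b

/-- The output stack grows at the front, so later letters yield earlier rows. This fits `attach`,
where the first letter belongs to the largest state, and allows the word to be written in reading
order. -/
theorem lineRows_append (d u : ℕ) (l l' : List Bool) :
    lineRows d u (l ++ l') = lineRows d (u + l.length) l' ++ lineRows (l'.length + d) u l := by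
  induction l generalizing u with
  | nil => simp [lineRows]
  | cons b l ih =>
    simp only [List.cons_append, lineRows, ih, List.length_cons, List.length_append,
      List.append_assoc]
    rw [show u + 1 + l.length = u + (l.length + 1) by ring,
      show l.length + l'.length + d = l.length + (l'.length + d) by ring]

/-- Write the row of a state of the line. -/
def emitRow (b : Bool) : Cmd (Fin 8) :=
  seq (zeros 5) (seq (push 7 [true, false]) (seq (pop 6) (seq (zeros 6)
    (seq (push 7 (List.ofFn (Core.lineLabel b))) (push 5 [true])))))

/-- The counter `up` holds how many states are larger than the current one, `down` holds its number.
Popping `down` yields the number of its only successor. The row is written from right to left. -/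
theorem runs_emitRow (b : Bool) (inp cnt acc aux out : List Bool) (u d : ℕ) :
    Runs (emitRow b) (st inp [] cnt acc aux (unary u) (unary (d + 1)) out) (5 * (u + d) + 8)
      (st inp [] cnt acc aux (unary (u + 1)) (unary d) (lineRow d u b ++ out)) := by
  have h1 := runs_zeros_up inp cnt acc aux (unary (d + 1)) out u
  have h2 := runs_zeros_down inp cnt acc aux (unary u) (true :: zeroWord (u + 1) ++ out) d
  refine ((h1.seq ((runs_push (s' := st inp [] cnt acc aux (unary u) (unary (d + 1))
    (true :: zeroWord (u + 1) ++ out)) ?_).seq ((runs_pop ?_).seq (h2.seq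
    ((runs_push rfl).seq (runs_push ?_)))))).mono (by omega))
  · simp [zeroWord, List.replicate_succ]
  · simp [unary, List.replicate_succ]
  · simp [unary, List.replicate_succ, lineRow]

/-- Write rows of the line. -/
def emitRows : List Bool → Cmd (Fin 8)
  | [] => push 7 []
  | b :: l => seq (emitRow b) (emitRows l)

/-- Each row moves one unit from `down` to `up`; the sum is constant, so one `B` bounds the time for
every row. -/
theorem runs_emitRows {B : ℕ} (l : List Bool) (inp cnt acc aux out : List Bool) (u d : ℕ)
    (hB : u + l.length + d ≤ B) :
    Runs (emitRows l) (st inp [] cnt acc aux (unary u) (unary (l.length + d)) out)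
      (l.length * (5 * B + 8) + 1)
      (st inp [] cnt acc aux (unary (u + l.length)) (unary d) (lineRows d u l ++ out)) := by
  induction l generalizing u out with
  | nil =>
    simp only [List.length_nil, zero_mul, zero_add, add_zero]
    exact runs_push (by simp [lineRows])
  | cons b l ih =>
    simp only [List.length_cons] at hB
    have h1 := runs_emitRow b inp cnt acc aux out u (l.length + d)
    have h2 := ih (lineRow (l.length + d) u b ++ out) (u + 1) (by omega)
    simp only [List.length_cons, lineRows, List.append_assoc]
    rw [show l.length + 1 + d = l.length + d + 1 by ring,
      show u + (l.length + 1) = u + 1 + l.length by ring]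
    refine (h1.seq h2).mono ?_
    nlinarith

theorem runs_emit_input {w B : ℕ} {code : Bool → List Bool} (hw : ∀ b, (code b).length = w)
    (x cnt acc aux out : List Bool) (d : ℕ) (hB : w * x.length + d ≤ B) :
    Runs (loop 0 fun b => emitRows (code b))
      (st x [] cnt acc aux [] (unary (w * x.length + d)) out)
      ((w * (5 * B + 8) + 2) * x.length + 1)
      (st [] [] cnt acc aux (unary (w * x.length)) (unary d)
        (lineRows d 0 (x.flatMap code) ++ out)) := by
  have hl : ∀ l : List Bool, (l.flatMap code).length = w * l.length := fun l => by
    simp [List.length_flatMap, hw, mul_comm]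
  have h1 := runs_loop (k := 0) (f := fun b => emitRows (code b)) (L := x)
    (T := w * (5 * B + 8) + 1)
    (fun l r => st r [] cnt acc aux (unary (w * l.length)) (unary (w * r.length + d))
      (lineRows (w * r.length + d) 0 (l.flatMap code) ++ out)) (fun _ _ => rfl) ?_
  · simpa [lineRows] using h1
  · intro l b r hx
    have hx' : x.length = l.length + (r.length + 1) := by rw [← hx]; simp
    have h2 := runs_emitRows (B := B) (code b) r cnt acc aux
      (lineRows (w * (b :: r).length + d) 0 (l.flatMap code) ++ out) (w * l.length)
      (w * r.length + d) (by
        rw [hw]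
        rw [hx'] at hB
        have h3 : w * (l.length + (r.length + 1)) = w * l.length + w + w * r.length := by ring
        omega)
    rw [hw] at h2
    simp only [update_st_zero]
    convert h2 using 2
    · simp only [List.length_cons]; ring_nf
    · simp only [List.length_append, List.length_singleton]; ring_nf
    · simp only [List.flatMap_append, lineRows_append, List.flatMap_singleton, hw, hl,
        List.length_cons, List.append_assoc, zero_add]
      rw [show w + (w * r.length + d) = w * (r.length + 1) + d by ring]

theorem runs_emit_blanks {w B : ℕ} {blank : List Bool} (hw : blank.length = w)
    (cnt acc out : List Bool) (P u d : ℕ) (hB : u + w * P + d ≤ B) :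
    Runs (loop 4 fun _ => emitRows blank)
      (st [] [] cnt acc (unary P) (unary u) (unary (w * P + d)) out)
      ((w * (5 * B + 8) + 2) * P + 1)
      (st [] [] cnt acc [] (unary (u + w * P)) (unary d)
        (lineRows d u (List.replicate P blank).flatten ++ out)) := by
  have hl : ∀ l : ℕ, (List.replicate l blank).flatten.length = w * l := fun l => by
    simp [hw, mul_comm]
  have h1 := runs_loop_unary (k := 4) (f := fun _ => emitRows blank) (n := P)
    (T := w * (5 * B + 8) + 1)
    (fun l r => st [] [] cnt acc (unary r) (unary (u + w * l)) (unary (w * r + d))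
      (lineRows (w * r + d) u (List.replicate l blank).flatten ++ out)) (fun _ _ => rfl) ?_
  · simpa [lineRows] using h1
  · intro l r hP
    have h2 := runs_emitRows (B := B) blank [] cnt acc (unary r)
      (lineRows (w * (r + 1) + d) u (List.replicate l blank).flatten ++ out) (u + w * l)
      (w * r + d) (by
        rw [hw]
        rw [← hP] at hB
        have h3 : w * (l + (r + 1)) = w * l + w + w * r := by ring
        omega)
    rw [hw] at h2
    simp only [update_st_four]
    convert h2 using 2
    · ring_nf
    · ring_nf
    · rw [List.replicate_succ', List.flatten_append, lineRows_append, hl]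
      simp only [List.flatten_cons, List.flatten_nil, List.append_nil, hw, List.append_assoc]
      rw [show w + (w * r + d) = w * (r + 1) + d by ring]

/-- Write the rows of the core, where a row is given without the edges to the line. -/
def emitCore : List (List Bool) → Cmd (Fin 8)
  | [] => push 7 []
  | c :: R => seq (emitCore R) (seq (push 7 [true]) (seq (zeros 5) (push 7 c)))

theorem runs_emitCore (R : List (List Bool)) (down out : List Bool) (u : ℕ) :
    Runs (emitCore R) (st [] [] [] [] [] (unary u) down out) (R.length * (5 * u + 4) + 1)
      (st [] [] [] [] [] (unary u) down
        ((R.map fun c => c ++ (zeroWord u ++ [true])).flatten ++ out)) := by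
  induction R with
  | nil => exact (runs_push (by simp)).mono (Nat.le_add_left 1 _)
  | cons c R ih =>
    have h1 := runs_zeros_up [] [] [] [] down
      (true :: ((R.map fun c => c ++ (zeroWord u ++ [true])).flatten ++ out)) u
    refine (ih.seq ((runs_push (s' := st [] [] [] [] [] (unary u) down
      (true :: ((R.map fun c => c ++ (zeroWord u ++ [true])).flatten ++ out))) ?_).seq
      (h1.seq (runs_push ?_)))).mono ?_
    · simp
    · simp
    · simp only [List.length_cons]
      ring_nf
      omega

/-! ### Unary arithmetic for the space bound -/

/-- Multiply the third counter by the second one. -/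
def mult : Cmd (Fin 8) :=
  seq (loop 3 fun _ => seq (loop 2 fun _ => seq (push 4 [true]) (push 1 [true]))
    (loop 1 fun _ => push 2 [true])) (loop 4 fun _ => push 3 [true])

theorem runs_mult (inp down : List Bool) (k p : ℕ) :
    Runs mult (st inp [] (unary k) (unary p) [] [] down [])
      ((5 * k + 3) * p + 2 * (p * k) + 2)
      (st inp [] (unary k) (unary (p * k)) [] [] down []) := by
  have h1 : ∀ p q, Runs (seq (loop 2 fun _ => seq (push 4 [true]) (push 1 [true]))
      (loop 1 fun _ => push 2 [true])) (st inp [] (unary k) (unary p) (unary q) [] down [])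
      (5 * k + 2) (st inp [] (unary k) (unary p) (unary (q + k)) [] down []) := by
    intro p q
    have h1 := runs_loop_unary (k := 2) (f := fun _ => seq (push 4 [true]) (push 1 [true]))
      (n := k) (T := 1 + 1)
      (fun d r => st inp (unary d) (unary r) (unary p) (unary (q + d)) [] down [])
      (fun _ _ => rfl) (fun d r _ => Runs.seq (runs_push rfl) (runs_push (by
        simp [unary, List.replicate_succ, ← add_assoc])))
    have h2 := runs_loop_unary (k := 1) (f := fun _ => push 2 [true])
      (n := k) (T := 1)
      (fun d r => st inp (unary r) (unary d) (unary p) (unary (q + k)) [] down [])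
      (fun _ _ => rfl) (fun d r _ => runs_push (by simp [unary, List.replicate_succ]))
    exact (h1.seq h2).mono (by omega)
  have h2 := runs_loop_unary (k := 3) (f := fun _ => seq (loop 2 fun _ => seq (push 4 [true])
    (push 1 [true])) (loop 1 fun _ => push 2 [true])) (n := p) (T := 5 * k + 2)
    (fun d r => st inp [] (unary k) (unary r) (unary (d * k)) [] down []) (fun _ _ => rfl)
    (fun d r _ => by
      have := h1 r (d * k)
      simpa [add_mul] using this)
  have h3 := runs_loop_unary (k := 4) (f := fun _ => push 3 [true]) (n := p * k) (T := 1)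
    (fun d r => st inp [] (unary k) (unary d) (unary r) [] down []) (fun _ _ => rfl)
    (fun d r _ => runs_push (by simp [unary, List.replicate_succ]))
  simp only [zero_mul] at h2
  exact (h2.seq h3).mono (by ring_nf; omega)

/-- Raise the second counter to a power. -/
def power : ℕ → Cmd (Fin 8)
  | 0 => push 3 [true]
  | e + 1 => seq (power e) mult

/-- A bound for the running time of `power`. -/
def powerTime (k : ℕ) : ℕ → ℕ
  | 0 => 1
  | e + 1 => powerTime k e + ((5 * k + 3) * k ^ e + 2 * (k ^ e * k) + 2)

theorem runs_power (inp down : List Bool) (k e : ℕ) :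
    Runs (power e) (st inp [] (unary k) [] [] [] down []) (powerTime k e)
      (st inp [] (unary k) (unary (k ^ e)) [] [] down []) := by
  induction e with
  | zero => exact runs_push (by simp [unary])
  | succ e ih =>
    rw [pow_succ]
    exact ih.seq (runs_mult inp down k (k ^ e))

/-- Prepare the counters. -/
def prepare (c e m w : ℕ) : Cmd (Fin 8) :=
  seq (push 2 (unary c)) (seq (push 6 (unary (m + 1)))
    (seq (loop 0 fun b => seq (push 1 [b]) (seq (push 2 [true]) (push 6 (unary w))))
    (seq (loop 1 fun b => push 0 [b]) (seq (power e) (seq (loop 2 fun _ => push 2 [])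
    (seq (loop 3 fun _ => seq (push 4 [true]) (push 6 (unary w))) (pop 6)))))))

/-- A loop destroys the stack that it reads, so the input is moved to the scratch stack, which
reverses it, and back. Multiplication by the constant `w` amounts to pushing `w` ones per letter or
blank. -/
theorem runs_prepare (x : List Bool) (c e m w : ℕ) :
    Runs (prepare c e m w) (st x [] [] [] [] [] [] [])
      (8 * (x.length + c) + 3 * (x.length + c) ^ e + powerTime (x.length + c) e + 8)
      (st x [] [] [] (unary ((x.length + c) ^ e)) []
        (unary (w * x.length + (w * (x.length + c) ^ e + m))) []) := by
  have h1 := runs_loop (k := 0)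
    (f := fun b => seq (push 1 [b]) (seq (push 2 [true]) (push 6 (unary w)))) (L := x)
    (T := 1 + (1 + 1)) (fun d r => st r d.reverse (unary (d.length + c)) [] [] []
      (unary (w * d.length + (m + 1))) []) (fun _ _ => rfl)
    (fun d b r _ => (runs_push rfl).seq ((runs_push rfl).seq (runs_push (by
      simp only [update_st_zero, update_st_one, update_st_two, update_st_six, st_one, st_two,
        st_six, List.length_append, List.length_singleton, unary, List.replicate_append_replicate,
        List.reverse_append, List.reverse_singleton, ← List.replicate_succ, List.singleton_append]
      ring_nf))))
  have h2 := runs_loop (k := 1) (f := fun b => push 0 [b]) (L := x.reverse)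
    (T := 1) (fun d r => st d.reverse r (unary (x.length + c)) [] [] []
      (unary (w * x.length + (m + 1))) []) (fun _ _ => rfl)
    (fun d b r _ => runs_push (by simp))
  have h3 := runs_power x (unary (w * x.length + (m + 1))) (x.length + c) e
  have h4 := runs_loop_unary (k := 2) (f := fun _ => push 2 []) (n := x.length + c) (T := 1)
    (fun _ r => st x [] (unary r) (unary ((x.length + c) ^ e)) [] []
      (unary (w * x.length + (m + 1))) []) (fun _ _ => rfl) (fun d r _ => runs_push (by simp))
  have h5 := runs_loop_unary (k := 3) (f := fun _ => seq (push 4 [true]) (push 6 (unary w)))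
    (n := (x.length + c) ^ e) (T := 1 + 1)
    (fun d r => st x [] [] (unary r) (unary d) []
      (unary (w * x.length + (w * d + (m + 1)))) []) (fun _ _ => rfl)
    (fun d r _ => (runs_push rfl).seq (runs_push (by
      simp only [update_st_three, update_st_four, update_st_six, st_four, st_six, unary,
        List.replicate_append_replicate, ← List.replicate_succ, List.singleton_append]
      ring_nf)))
  simp only [List.length_nil, mul_zero, zero_add] at h1 h5
  simp only [List.length_reverse, List.reverse_reverse] at h2
  refine (Runs.seq (runs_push (s' := st x [] (unary c) [] [] [] [] []) ?_)
    (Runs.seq (runs_push ?_) (h1.seq (h2.seq (h3.seq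
    (h4.seq (h5.seq (runs_pop ?_)))))))).mono ?_
  · simp
  · simp
  · simp only [st_six, update_st_six, ← add_assoc, unary, List.replicate_succ, List.tail_cons]
    rfl
  · generalize (x.length + c) ^ e = y
    omega

/-- Write the encoding of a core with an attached line, given the number `m + 1` of its states,
its start state and its rows without the edges to the line. -/
def program (c e m start w : ℕ) (code : Bool → List Bool) (blank : List Bool)
    (R : List (List Bool)) : Cmd (Fin 8) :=
  seq (prepare c e m w) (seq (loop 0 fun b => emitRows (code b)) (seq (loop 4 fun _ =>
    emitRows blank) (seq (pop 5) (seq (emitCore R) (seq (push 7 (unary (m + 2) ++ false ::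
    (unary 5 ++ false :: (unary start ++ [false])))) (seq (loop 5 fun _ => push 7 [true])
    (loop 6 fun _ => push 6 [])))))))

/-- The running time of `program` on inputs of length `n`. -/
def programTime (c e m w k n : ℕ) : ℕ :=
  8 * (n + c) + 3 * (n + c) ^ e + powerTime (n + c) e + 8 +
    ((w * (5 * (w * n + w * (n + c) ^ e + m) + 8) + 2) * n + 1 +
      ((w * (5 * (w * n + w * (n + c) ^ e + m) + 8) + 2) * (n + c) ^ e + 1 +
        (1 + (k * (5 * (w * n + w * (n + c) ^ e) + 4) + 1 +
          (1 + (2 * (w * n + w * (n + c) ^ e) + 1 + (2 * m + 1)))))))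

/-- After the line is written, `up` holds its length `u + 1`. One unit is popped, since the part of
a core row beyond the core is `u` zeros and a one. The remaining `u` units complete the prefix `m +
2` to the number of states. -/
theorem runs_program {c e m start w : ℕ} {code : Bool → List Bool} {blank : List Bool}
    {R : List (List Bool)} (hw : ∀ b, (code b).length = w) (hw' : blank.length = w)
    (x : List Bool) {u : ℕ}
    (hu : u + 1 = w * x.length + w * (x.length + c) ^ e) :
    Runs (program c e m start w code blank R) (st x [] [] [] [] [] [] [])
      (programTime c e m w R.length x.length)
      (st [] [] [] [] [] [] [] (unary (m + 1 + (u + 1)) ++ false :: (unary 5 ++ false ::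
        (unary start ++ false :: ((R.map fun c => c ++ (zeroWord u ++ [true])).flatten ++
          lineRows m 0 (x.flatMap code ++
            (List.replicate ((x.length + c) ^ e) blank).flatten)))))) := by
  have h1 := runs_prepare x c e m w
  have h2 := runs_emit_input hw x [] [] (unary ((x.length + c) ^ e)) []
    (w * (x.length + c) ^ e + m) (B := w * x.length + w * (x.length + c) ^ e + m) (by omega)
  have h3 := runs_emit_blanks hw' [] []
    (lineRows (w * (x.length + c) ^ e + m) 0 (x.flatMap code) ++ []) ((x.length + c) ^ e)
    (w * x.length) m (B := w * x.length + w * (x.length + c) ^ e + m) (by omega)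
  rw [← hu] at h3
  set out := lineRows m (w * x.length) (List.replicate ((x.length + c) ^ e) blank).flatten ++
    (lineRows (w * (x.length + c) ^ e + m) 0 (x.flatMap code) ++ []) with hout
  have hout' : lineRows m 0 (x.flatMap code ++
      (List.replicate ((x.length + c) ^ e) blank).flatten) = out := by
    rw [lineRows_append, hout]
    have hl : (x.flatMap code).length = w * x.length := by
      simp [List.length_flatMap, hw, mul_comm]
    have hl' : (List.replicate ((x.length + c) ^ e) blank).flatten.length =
        w * (x.length + c) ^ e := by
      simp [hw', mul_comm]
    rw [hl, hl', zero_add, List.append_nil]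
  have h4 := runs_emitCore R (unary m) out u
  rw [hout']
  set out' := (R.map fun c => c ++ (zeroWord u ++ [true])).flatten ++ out
  have h5 := runs_loop_unary (k := 5) (f := fun _ => push 7 [true]) (n := u) (T := 1)
    (fun d r => st [] [] [] [] [] (unary r) (unary m) (unary (d + (m + 2)) ++ false ::
    (unary 5 ++ false :: (unary start ++ false :: out')))) (fun _ _ => rfl)
    (fun d r _ => runs_push (by
      rw [show d + 1 + (m + 2) = d + (m + 2) + 1 by ring]
      simp [unary, List.replicate_succ]))
  have h6 := runs_loop_unary (k := 6) (f := fun _ => push 6 []) (n := m) (T := 1)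
    (fun _ r => st [] [] [] [] [] [] (unary r) (unary (u + (m + 2)) ++ false ::
    (unary 5 ++ false :: (unary start ++ false :: out')))) (fun _ _ => rfl)
    (fun d r _ => runs_push (by simp))
  rw [show m + 1 + (u + 1) = u + (m + 2) by ring]
  refine (h1.seq (h2.seq (h3.seq ((runs_pop ?_).seq (h4.seq ((runs_push ?_).seq
    (h5.seq h6))))))).mono ?_
  · simp [unary, List.replicate_succ]
  · simp
  · rw [programTime, ← hu]
    gcongr <;> omega

end Cmd

/-! ### The output of the program is the encoding -/

open Cmd

/-- The recursion follows the word, the encoding follows the state numbers; the first letter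
accounts for the last row. -/
theorem Cmd.lineRows_eq_flatten (d u : ℕ) (l : List Bool) :
    lineRows d u l = (List.ofFn fun j : Fin l.length =>
      lineRow (j + d) (u + (l.length - 1 - j)) (l.getD (l.length - 1 - j) false)).flatten := by
  induction l generalizing u with
  | nil => simp [lineRows]
  | cons b l ih =>
    have h1 : (List.ofFn fun j : Fin (b :: l).length => lineRow (j + d)
        (u + ((b :: l).length - 1 - j)) ((b :: l).getD ((b :: l).length - 1 - j) false)) =
        (List.ofFn fun j : Fin l.length => lineRow (j + d) (u + 1 + (l.length - 1 - j))
          (l.getD (l.length - 1 - j) false)) ++ [lineRow (l.length + d) u b] := by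
      change (List.ofFn (n := l.length + 1) _) = _
      rw [List.ofFn_succ_last]
      congr 1
      · congr 1
        funext j
        have h2 : (b :: l).length - 1 - j.1 = l.length - 1 - j + 1 := by
          simp only [List.length_cons]; omega
        simp only [Fin.val_castSucc, h2, List.getD_cons_succ]
        rw [show u + (l.length - 1 - j.1 + 1) = u + 1 + (l.length - 1 - j) by ring]
      · simp
    rw [h1, lineRows, ih]
    simp

namespace Core

variable (C : Core) (ℓ : List Bool)

/-- The rows of the core without the edges to the line. -/
def coreRows : List (List Bool) :=
  List.ofFn fun q => List.ofFn (C.label q) ++ List.ofFn (C.edge q)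

theorem edge_attach_of_lt {s t : Fin (C.size + ℓ.length)} (hs : s.1 < C.size)
    (ht : ¬ t.1 < C.size) :
    (C.attach ℓ).edge s t = decide (t.1 + 1 = C.size + ℓ.length) := by
  simp [attach, hs, ht]

theorem edge_attach_of_not_lt {s t : Fin (C.size + ℓ.length)} (hs : ¬ s.1 < C.size) :
    (C.attach ℓ).edge s t = decide (t.1 + 1 = s.1) := by
  simp [attach, hs]

theorem ofFn_edge_attach_core {u : ℕ} (hu : ℓ.length = u + 1) (q : Fin C.size) :
    List.ofFn ((C.attach ℓ).edge (Fin.castAdd ℓ.length q)) =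
      List.ofFn (C.edge q) ++ (zeroWord u ++ [true]) := by
  refine (List.ofFn_add (n := C.size) (m := ℓ.length)).trans ?_
  congr 1
  · congr 1
    funext t
    have h : ¬ (t.1 + 1 = C.size + ℓ.length) := by omega
    simp [attach, h]
  · refine List.ext_getElem (by simp [hu]) fun i h1 h2 => ?_
    simp only [List.length_ofFn] at h1
    rw [List.getElem_ofFn]
    refine (C.edge_attach_of_lt ℓ q.2 (not_lt.2 (Nat.le_add_right C.size i))).trans ?_
    change decide (C.size + i + 1 = C.size + ℓ.length) = _
    simp only [List.getElem_append, List.length_replicate, List.getElem_replicate]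
    split_ifs with h3
    · rw [decide_eq_false_iff_not]; omega
    · have : C.size + i + 1 = C.size + ℓ.length := by omega
      simp [this]

/-- The successor has the number `C.size + j - 1` for all `j`; the end of the line, whose successor
is the last core state, is no exception. -/
theorem ofFn_edge_attach_line (j : Fin ℓ.length) :
    List.ofFn ((C.attach ℓ).edge (Fin.natAdd C.size j)) =
      zeroWord (j + (C.size - 1)) ++ true :: zeroWord (ℓ.length - 1 - j + 1) := by
  have h0 := C.start.pos
  refine List.ext_getElem ?_ fun i h1 h2 => ?_
  · simp [attach]; omega
  · simp only [List.length_ofFn] at h1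
    change i < C.size + ℓ.length at h1
    rw [List.getElem_ofFn]
    refine (C.edge_attach_of_not_lt ℓ (not_lt.2 (Nat.le_add_right C.size j))).trans ?_
    change decide (i + 1 = C.size + j) = _
    simp only [List.getElem_append, List.length_replicate, List.getElem_replicate,
      List.getElem_cons]
    split_ifs
    · rw [decide_eq_false_iff_not]; omega
    · rw [decide_eq_true_eq]; omega
    · rw [decide_eq_false_iff_not]; omega

theorem encode_attach {u : ℕ} (hu : ℓ.length = u + 1) :
    (C.attach ℓ).encode = unary (C.size - 1 + 1 + (u + 1)) ++ false :: (unary 5 ++ false ::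
      (unary C.start ++ false :: ((C.coreRows.map fun c => c ++ (zeroWord u ++ [true])).flatten ++
        lineRows (C.size - 1) 0 ℓ))) := by
  have h0 := C.start.pos
  have h1 : C.size - 1 + 1 + (u + 1) = C.size + ℓ.length := by omega
  have h2 : (List.ofFn fun s : Fin (C.attach ℓ).numStates =>
      List.ofFn ((C.attach ℓ).label s) ++ List.ofFn ((C.attach ℓ).edge s)) =
      (C.coreRows.map fun c => c ++ (zeroWord u ++ [true])) ++
      (List.ofFn fun j : Fin ℓ.length => lineRow (j + (C.size - 1)) (0 + (ℓ.length - 1 - j))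
        (ℓ.getD (ℓ.length - 1 - j) false)) := by
    refine (List.ofFn_add (n := C.size) (m := ℓ.length)).trans ?_
    congr 1
    · rw [coreRows, List.map_ofFn]
      congr 1
      funext q
      have h3 := C.ofFn_edge_attach_core ℓ hu q
      simp only [Function.comp_def, List.append_assoc]
      rw [← h3]
      congr 2
      funext p
      simp [attach]
    · congr 1
      funext j
      rw [ofFn_edge_attach_line, lineRow, zero_add]
      congr 2
      funext p
      simp only [attach, Fin.val_natAdd, not_lt.2 (Nat.le_add_right C.size j), dite_false]
      rw [show C.size + ℓ.length - 1 - (C.size + j.1) = ℓ.length - 1 - j by omega]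
  rw [FinKripke.encode, h2, h1, lineRows_eq_flatten, List.flatten_append]
  rfl

end Core

/-! ### Polynomial bounds -/

/-- A function is bounded by a polynomial. -/
def PolyBounded (T : ℕ → ℕ) : Prop := ∃ p : Polynomial ℕ, ∀ n, T n ≤ p.eval n

namespace PolyBounded

theorem const (a : ℕ) : PolyBounded fun _ => a := ⟨Polynomial.C a, by simp⟩

theorem id : PolyBounded fun n => n := ⟨Polynomial.X, by simp⟩

theorem add {S T : ℕ → ℕ} (hS : PolyBounded S) (hT : PolyBounded T) :
    PolyBounded fun n => S n + T n :=
  let ⟨p, hp⟩ := hS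
  let ⟨q, hq⟩ := hT
  ⟨p + q, fun n => by rw [Polynomial.eval_add]; exact add_le_add (hp n) (hq n)⟩

theorem mul {S T : ℕ → ℕ} (hS : PolyBounded S) (hT : PolyBounded T) :
    PolyBounded fun n => S n * T n :=
  let ⟨p, hp⟩ := hS
  let ⟨q, hq⟩ := hT
  ⟨p * q, fun n => by rw [Polynomial.eval_mul]; exact Nat.mul_le_mul (hp n) (hq n)⟩

theorem pow {S : ℕ → ℕ} (hS : PolyBounded S) (e : ℕ) : PolyBounded fun n => S n ^ e :=
  let ⟨p, hp⟩ := hS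
  ⟨p ^ e, fun n => by rw [Polynomial.eval_pow]; exact Nat.pow_le_pow_left (hp n) e⟩

theorem powerTime {S : ℕ → ℕ} (hS : PolyBounded S) (e : ℕ) :
    PolyBounded fun n => Cmd.powerTime (S n) e := by
  induction e with
  | zero => exact const 1
  | succ e ih =>
    exact ih.add (((((const 5).mul hS).add (const 3)).mul (hS.pow e)).add
      ((const 2).mul ((hS.pow e).mul hS)) |>.add (const 2))

theorem programTime (c e m w k : ℕ) : PolyBounded (Cmd.programTime c e m w k) := by
  have h1 : PolyBounded fun n => n + c := id.add (const c)
  have h2 := h1.pow e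
  have h3 : PolyBounded fun n => w * n + w * (n + c) ^ e :=
    ((const w).mul id).add ((const w).mul h2)
  have h4 : PolyBounded fun n => w * (5 * (w * n + w * (n + c) ^ e + m) + 8) + 2 :=
    ((const w).mul (((const 5).mul (h3.add (const m))).add (const 8))).add (const 2)
  exact ((((const 8).mul h1).add ((const 3).mul h2)).add (h1.powerTime e) |>.add (const 8)).add
    (((h4.mul id).add (const 1)).add (((h4.mul h2).add (const 1)).add
      ((const 1).add ((((const k).mul (((const 5).mul h3).add (const 4))).add (const 1)).add
        ((const 1).add ((((const 2).mul h3).add (const 1)).add (const (2 * m + 1))))))))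

end PolyBounded

/-- The program computes only powers of a shifted input length, so the space bound is replaced by
one. For a sum, the base is at least `2`, and one more factor of it absorbs the doubling. -/
theorem Polynomial.exists_eval_le_add_pow (p : Polynomial ℕ) :
    ∃ c e : ℕ, ∀ n, p.eval n ≤ (n + (c + 1)) ^ e := by
  induction p using Polynomial.induction_on' with
  | add p q hp hq =>
    obtain ⟨c, e, h⟩ := hp
    obtain ⟨c', e', h'⟩ := hq
    refine ⟨c + c' + 1, e + e' + 1, fun n => ?_⟩
    have hb : 2 ≤ n + (c + c' + 1 + 1) := by omega
    calc (p + q).eval n ≤ (n + (c + 1)) ^ e + (n + (c' + 1)) ^ e' := by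
          rw [Polynomial.eval_add]; exact add_le_add (h n) (h' n)
      _ ≤ (n + (c + c' + 1 + 1)) ^ (e + e') + (n + (c + c' + 1 + 1)) ^ (e + e') :=
          add_le_add
            ((Nat.pow_le_pow_left (by omega) e).trans (Nat.pow_le_pow_right (by omega) (by omega)))
            ((Nat.pow_le_pow_left (by omega) e').trans
              (Nat.pow_le_pow_right (by omega) (by omega)))
      _ = (n + (c + c' + 1 + 1)) ^ (e + e') * 2 := by ring
      _ ≤ (n + (c + c' + 1 + 1)) ^ (e + e' + 1) := by
          rw [pow_succ]; exact Nat.mul_le_mul_left _ hb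
  | monomial k a =>
    refine ⟨a, k + 1, fun n => ?_⟩
    rw [Polynomial.eval_monomial, pow_succ, mul_comm]
    exact Nat.mul_le_mul (Nat.pow_le_pow_left (by omega) k) (by omega)

/-! ### The reduction -/

namespace SpaceTM

variable (M : SpaceTM)

/-- The reduction for a machine that scans at most `(n + c) ^ e` cells. -/
noncomputable def reduction (c e : ℕ) (x : List Bool) : FinKripke :=
  M.delaySystem.core.attach (M.delaySystem.bits (M.firstRow x ((x.length + c) ^ e)))

theorem bits_firstRow (x : List Bool) (P : ℕ) : M.delaySystem.bits (M.firstRow x P) =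
    (x.flatMap fun b => List.ofFn (M.delaySystem.code (Sum.inr (M.input b, none)))) ++
      (List.replicate P (List.ofFn (M.delaySystem.code (Sum.inr (M.blank, none))))).flatten := by
  simp only [DelaySystem.bits, firstRow, List.flatMap_append, List.flatMap_map]
  congr 1
  simp [List.flatMap]

/-- The machine `M` enters the program only through constants: the rows of the core, the code words
and the exponent. -/
theorem polyTime_reduction (c e : ℕ) : Nonempty (Turing.TM2ComputableInPolyTime
    (fun x : List Bool => x) FinKripke.encode (M.reduction (c + 1) e)) := by
  set D := M.delaySystem
  obtain ⟨T, hT⟩ := PolyBounded.programTime (c + 1) e (D.core.size - 1) D.width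
    D.core.coreRows.length
  refine polyTime_of_run (Cmd.program (c + 1) e (D.core.size - 1) D.core.start D.width
    (fun b => List.ofFn (D.code (Sum.inr (M.input b, none))))
    (List.ofFn (D.code (Sum.inr (M.blank, none)))) D.core.coreRows) 0 7 T fun x => ?_
  have hpos : 0 < D.width * (x.length + (c + 1)) ^ e :=
    Nat.mul_pos D.width_pos (Nat.pow_pos (by omega))
  obtain ⟨u, hu⟩ := Nat.exists_eq_add_of_le' (show 1 ≤ D.width * x.length +
    D.width * (x.length + (c + 1)) ^ e by omega)
  have hlen : (D.bits (M.firstRow x ((x.length + (c + 1)) ^ e))).length = u + 1 := by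
    rw [D.length_bits, length_firstRow, ← hu]
    ring
  obtain ⟨n, hn, hr⟩ := runs_program (R := D.core.coreRows) (m := D.core.size - 1)
    (start := D.core.start)
    (code := fun b => List.ofFn (D.code (Sum.inr (M.input b, none))))
    (blank := List.ofFn (D.code (Sum.inr (M.blank, none)))) (w := D.width)
    (fun b => List.length_ofFn) List.length_ofFn x hu.symm
  refine ⟨n, hn.trans (hT _), ?_⟩
  rw [← bits_firstRow, ← D.core.encode_attach _ hlen] at hr
  convert hr using 1
  · funext i; fin_cases i <;> rfl
  · funext i; fin_cases i <;> rfl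

theorem reduction_mem_iff (c e k : ℕ) {x : List Bool}
    (h : ∀ t, (M.run x t).head < (x.length + c) ^ e) :
    M.reduction c e x ∈ modelChecking (HyperCTL.paddedFormula k) ↔
      ∃ t, (M.run x t).state = M.accept := by
  have h0 : 0 < (x.length + c) ^ e := (Nat.zero_le _).trans_lt (h 0)
  have hne : M.delaySystem.bits (M.firstRow x ((x.length + c) ^ e)) ≠ [] := by
    rw [← List.length_pos_iff, DelaySystem.length_bits, length_firstRow]
    exact Nat.mul_pos (by omega) M.delaySystem.width_pos
  exact (Core.attach_satisfies_iff M.delaySystem.core_label_one hne k).trans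
    ((M.delaySystem.exists_delayRun_iff _).trans
      -- The blanks behind the input alone already outnumber the scanned cells.
      (exists_accepting_run_iff fun t => (h t).trans_le (Nat.le_add_left _ _)))

end SpaceTM

theorem mainTheorem3 (k : ℕ) (hk : 2 ≤ k) :
    ∃ φ : HyperCTL 0, φ.IsSpecification ∧ φ.alternationDepth = k ∧
      PSPACEHard FinKripke.encode (modelChecking φ) := by
  refine ⟨HyperCTL.paddedFormula k, HyperCTL.isSpecification_paddedFormula k,
    HyperCTL.alternationDepth_paddedFormula hk, ?_⟩
  rintro L ⟨M, p, hM⟩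
  obtain ⟨c, e, hp⟩ := p.exists_eval_le_add_pow
  refine ⟨M.reduction (c + 1) e, M.polyTime_reduction c e, fun x => ?_⟩
  rw [hM.mem_iff x, M.reduction_mem_iff _ _ _ fun t => ((hM x).2.2 t).trans_le (hp _)]
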